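/- **Conventions.** $(a)_n=a(a+1)\cdots(a+n-1)$. The Gegenbauer polynomials $C_n^\lambda(x)$ are defined by $\sum_{n\ge 0}C_n^\lambda(x)t^n=(1-2xt+t^2)^{-\lambda}$, and $R=(1-2xt+t^2)^{1/2}$ with $R=1$ at $t=0$. For $\mu\neq 1,2,\dots$ the associated Legendre function is $$P_\nu^\mu(z)=\frac{2^\mu}{\Gamma(1-\mu)}(z^2-1)^{-\mu/2}\,{}_2F_1\!\left({-\nu-\mu,\;1+\nu-\mu\atop 1-\mu}\,\Big|\,\frac{1-z}{2}\right),\qquad z\in\mathbb C\setminus(-\infty,1],$$ and the Ferrers function $\mathrm P_\nu^\mu(z)$, $z\in\mathbb C\setminus((-\infty,-1]\cup[1,\infty))$, is given by the same formula with $1-z^2$ in place of $z^2-1$. Here ${}_2F_1$ is analytically continued to $\mathbb C\setminus[1,\infty)$, and the powers are the branches that are analytic on the respective domains and positive for real $\mu$ and for real $z>1$, resp. $z\in(-1,1)$. Let $\mathcal F_\nu^\mu(z)=(z^2-1)^{\mu/2}P_\nu^\mu(z)$ for $z\notin(-\infty,1]$, let $\mathcal F_\nu^\mu(z)=(1-z^2)^{\mu/2}\,\mathrm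 P_\nu^\mu(z)$ for $z\in(-1,1)$, and let $\mathcal F_\nu^\mu(1)=2^\mu/\Gamma(1-\mu)$ be the limiting value. **Theorem.** Let $\mu\in\mathbb C$ with $\mu\notin\{1/2,1,3/2,\dots\}$. Then, for all $x\in\mathbb C$, the following hold as equalities between power series in $t$ (i.e. for all sufficiently small complex $t$ the left-hand series converges to the right-hand side): $$\sum_{n=0}^\infty\frac{(-\nu-\mu)_n(1+\nu-\mu)_n}{(1-2\mu)_n(1-\mu)_n}\,C_n^{1/2-\mu}(x)\,t^n=2^{-2\mu}\,\Gamma(1-\mu)^2\,\mathcal F_\nu^\mu(R+t)\,\mathcal F_\nu^\mu(R-t)$$ for every $\nu\in\mathbb C$; and $$\sum_{n=0}^\infty\frac{(1/2-2\mu)_n(1/2)_n}{(1-2\mu)_n(1-\mu)_n}\,C_n^{1/2-\mu}(x)\,t^n=2^{-2\mu}\,\Gamma(1-\mu)^2\,(1-2xt)^{2\mu-1/2}\,\mathcal F_{-1/4}^\mu\!\left(\frac{2}{(R-t)^2}-1\right)\mathcal F_{-1/4}^\mu\!\left(\frac{2}{(R+t)^2}-1\right).$$ Moreover, the two definitions of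 $\mathcal F_\nu^\mu$ are equivalent: for every $\nu\in\mathbb C$, $\mathcal F_\nu^\mu(z)$ equals $(z^2-1)^{\mu/2}P_\nu^\mu(z)$ for all $z\in\mathbb C\setminus(-\infty,1]$ and equals $(1-z^2)^{\mu/2}\,\mathrm P_\nu^\mu(z)$ for all $z\in\mathbb C\setminus((-\infty,-1]\cup[1,\infty))$, and $\mathcal F_\nu^\mu$ is analytic at $z=1$. -/

import Mathlib

open scoped Topology

noncomputable section

/-- The Pochhammer symbol `(a)_n = a (a + 1) ⋯ (a + n - 1)`. -/
def poch (a : ℂ) (n : ℕ) : ℂ := (ascPochhammer ℂ n).eval a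

/-- The value `C_n^lam(x)` of the Gegenbauer polynomial: the coefficient of `t ^ n` in the Taylor
expansion at `t = 0` of the generating function `(1 - 2 x t + t ^ 2) ^ (-lam)`. -/
def gegenbauerC (lam : ℂ) (n : ℕ) (x : ℂ) : ℂ :=
  iteratedDeriv n (fun t : ℂ => (1 - 2 * x * t + t ^ 2) ^ (-lam)) 0 / (n.factorial : ℂ)

/-- `R = (1 - 2 x t + t ^ 2) ^ (1 / 2)`, with the branch that equals `1` at `t = 0`. -/
def genR (x t : ℂ) : ℂ := (1 - 2 * x * t + t ^ 2) ^ (1 / 2 : ℂ)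

open Classical in
/-- The Gauss function `₂F₁(a, b; c; w)` on the plane cut along `[1, ∞)`: the analytic function on
the cut plane that agrees near `w = 0` with the sum of the hypergeometric series. (It is unique
there by the identity theorem; Mathlib's `ordinaryHypergeometric` is the sum of the series, and is
meaningful on the unit disk only.) -/
def gaussF (a b c w : ℂ) : ℂ :=
  if h : ∃ g : ℂ → ℂ, AnalyticOnNhd ℂ g {v : ℂ | 1 - v ∈ Complex.slitPlane} ∧
      ∀ᶠ v in 𝓝 (0 : ℂ), g v = ordinaryHypergeometric a b c v
  then h.choose w
  else ordinaryHypergeometric a b c w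

/-- The branch of `(z ^ 2 - 1) ^ s` that is analytic on the plane cut along `(-∞, 1]` and positive
for real `s` and real `z > 1`. -/
def sqSubOnePow (z s : ℂ) : ℂ := (z - 1) ^ s * (z + 1) ^ s

/-- The associated Legendre function `P_ν^μ(z)` for `z ∉ (-∞, 1]` and `μ ≠ 1, 2, …`. -/
def legendreP (ν μ z : ℂ) : ℂ :=
  2 ^ μ / Complex.Gamma (1 - μ) * sqSubOnePow z (-μ / 2) *
    gaussF (-ν - μ) (1 + ν - μ) (1 - μ) ((1 - z) / 2)

/-- The Ferrers function of degree `ν` and order `μ`, for `z ∉ (-∞, -1] ∪ [1, ∞)` and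
`μ ≠ 1, 2, …`. -/
def ferrersP (ν μ z : ℂ) : ℂ :=
  2 ^ μ / Complex.Gamma (1 - μ) * (1 - z ^ 2) ^ (-μ / 2) *
    gaussF (-ν - μ) (1 + ν - μ) (1 - μ) ((1 - z) / 2)

/-- The domain `ℂ ∖ (-∞, 1]` of `P_ν^μ`. -/
def legendreDomain : Set ℂ := {z : ℂ | ¬ (z.im = 0 ∧ z.re ≤ 1)}

/-- The domain `ℂ ∖ ((-∞, -1] ∪ [1, ∞))` of the Ferrers function. -/
def ferrersDomain : Set ℂ := {z : ℂ | ¬ (z.im = 0 ∧ (z.re ≤ -1 ∨ 1 ≤ z.re))}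

open Classical in
/-- The function `𝓕_ν^μ` on `ℂ ∖ (-∞, -1]`: `(z ^ 2 - 1) ^ (μ / 2) P_ν^μ(z)` off `(-∞, 1]`, the
analogous expression in the Ferrers function on `(-1, 1)`, and at `z = 1` the common limit of the
two. The value on `(-∞, -1]` is irrelevant. -/
def scriptF (ν μ z : ℂ) : ℂ :=
  if z ∈ legendreDomain then sqSubOnePow z (μ / 2) * legendreP ν μ z
  else if z ∈ ferrersDomain then (1 - z ^ 2) ^ (μ / 2) * ferrersP ν μ z
  else if z = 1 then 2 ^ μ / Complex.Gamma (1 - μ)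
  else 0

end

/-! Put lam = 1/2 - μ, c = lam + 1/2 = 1 - μ, and F = ₂F₁(a, b; c; ·) with a + b = 2 lam. In the
variables p = (1 - R - t)/2 and q = (1 - R + t)/2 one has x t = p + q - 2pq and t = q - p, so
C_n^lam(x) t^n becomes a polynomial g_n in p and q. The core claim is Σ (a)_n (b)_n / ((2 lam)_n
(c)_n) g_n(p, q) = F(p) F(q) for small p, q (`exists_radius_hypergeometric`).

For fixed q, the operator D = p(1-p)∂² + c(1-2p)∂ sends g_{n+1} to a combination of g_{n+1} and g_n
(`hypOp_gegPoly_succ`). With the given coefficients the g_n terms telescope, so the sum solves the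
hypergeometric equation D f = a b f; here c(1-2p) is the usual c - (a+b+1)p, because a + b + 1 = 2c.
Since c is not a nonpositive integer, a solution analytic at 0 is determined by its value there
(`SolvesHyp.eq_zero`). At q = 0 the sum is F(p), so F solves the equation too; at p = 0 it is F(q).
Hence the sum equals F(q) F(p).

Near z = 1 the function 𝓕 is a constant times F((1-z)/2), which gives the first identity and the
analyticity. The companion identity is the case a = 2 lam - 1/2, b = 1/2, where a quadratic
transformation, again proved by uniqueness, rewrites each factor; the prefactors combine through (R
+ t)(R - t) = 1 - 2xt. -/

noncomputable section

/-! ### Homogenized Gegenbauer polynomials -/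

/-- The homogenized Gegenbauer polynomials: the coefficients of `(1 - 2 s r + τ r ^ 2) ^ (-lam)` in
powers of `r`, given by their three-term recurrence. -/
def gegSeq {A : Type*} [CommRing A] [Algebra ℂ A] (lam : ℂ) (s τ : A) : ℕ → A
  | 0 => 1
  | 1 => algebraMap ℂ A (2 * lam) * s
  | n + 2 => algebraMap ℂ A (1 / ((n : ℂ) + 2)) *
      (algebraMap ℂ A (2 * (n + 1 + lam)) * s * gegSeq lam s τ (n + 1) -
        algebraMap ℂ A (n + 2 * lam) * τ * gegSeq lam s τ n)

theorem gegSeq_rec {A : Type*} [CommRing A] [Algebra ℂ A] (lam : ℂ) (s τ : A) (n : ℕ) :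
    ((n : A) + 2) * gegSeq lam s τ (n + 2) =
      algebraMap ℂ A (2 * (n + 1 + lam)) * s * gegSeq lam s τ (n + 1) -
        algebraMap ℂ A (n + 2 * lam) * τ * gegSeq lam s τ n := by
  have h : ((n : A) + 2) * algebraMap ℂ A (1 / ((n : ℂ) + 2)) = 1 := by
    have h2 : (n : ℂ) + 2 ≠ 0 := by exact_mod_cast (by omega : n + 2 ≠ 0)
    have : ((n : A) + 2) = algebraMap ℂ A ((n : ℂ) + 2) := by
      rw [map_add, map_natCast, map_ofNat]
    rw [this, ← map_mul, mul_one_div_cancel h2, map_one]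
  rw [gegSeq, ← mul_assoc, h, one_mul]

theorem map_gegSeq {A B : Type*} [CommRing A] [Algebra ℂ A] [CommRing B] [Algebra ℂ B]
    (f : A →ₐ[ℂ] B) (lam : ℂ) (s τ : A) (n : ℕ) :
    f (gegSeq lam s τ n) = gegSeq lam (f s) (f τ) n := by
  induction n using Nat.strong_induction_on with
  | _ n ih =>
    match n with
    | 0 => simp [gegSeq]
    | 1 => simp [gegSeq]
    | n + 2 =>
      rw [gegSeq, gegSeq, ← ih n (by omega), ← ih (n + 1) (by omega)]
      simp only [map_mul, map_sub, AlgHom.commutes]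

/-- Weighted homogeneity, with s of weight 1 and τ of weight 2: it absorbs t ^ n into the arguments.
-/
theorem gegSeq_mul_sq {A : Type*} [CommRing A] [Algebra ℂ A] (lam : ℂ) (x t τ : A) (n : ℕ) :
    gegSeq lam (x * t) (τ * t ^ 2) n = gegSeq lam x τ n * t ^ n := by
  induction n using Nat.strong_induction_on with
  | _ n ih =>
    match n with
    | 0 => simp [gegSeq]
    | 1 => simp [gegSeq, mul_assoc]
    | n + 2 =>
      rw [gegSeq, gegSeq, ih n (by omega), ih (n + 1) (by omega)]
      ring

theorem eq_gegSeq_of_rec (lam s τ : ℂ) (u : ℕ → ℂ) (h0 : u 0 = 1) (h1 : u 1 = 2 * lam * s)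
    (h : ∀ n : ℕ, ((n : ℂ) + 2) * u (n + 2) =
      2 * (n + 1 + lam) * s * u (n + 1) - (n + 2 * lam) * τ * u n) (n : ℕ) :
    u n = gegSeq lam s τ n := by
  induction n using Nat.strong_induction_on with
  | _ n ih =>
    match n with
    | 0 => simp [gegSeq, h0]
    | 1 => simp [gegSeq, h1]
    | n + 2 =>
      have h2 : (n : ℂ) + 2 ≠ 0 := by exact_mod_cast (by omega : n + 2 ≠ 0)
      apply mul_left_cancel₀ h2
      rw [h, gegSeq_rec, ih n (by omega), ih (n + 1) (by omega)]
      simp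

theorem norm_gegSeq_le {lam s τ : ℂ} {δ : ℝ} (hs : ‖s‖ ≤ δ) (hτ : ‖τ‖ ≤ δ ^ 2) (n : ℕ) :
    ‖gegSeq lam s τ n‖ ≤ (3 * (1 + 2 * ‖lam‖) * δ) ^ n := by
  have hδ : 0 ≤ δ := (norm_nonneg _).trans hs
  have hl := norm_nonneg lam
  set L := 1 + 2 * ‖lam‖ with hL
  have hL1 : 1 ≤ L := by linarith
  induction n using Nat.strong_induction_on with
  | _ n ih =>
    match n with
    | 0 => simp [gegSeq]
    | 1 =>
      simp only [gegSeq, Algebra.algebraMap_self, RingHom.id_apply, norm_mul, pow_one]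
      have : ‖(2 : ℂ)‖ = 2 := by simp
      rw [this]
      nlinarith [mul_le_mul_of_nonneg_left hs hl, mul_nonneg hl hδ]
    | n + 2 =>
      have hrec := gegSeq_rec lam s τ n
      simp only [Algebra.algebraMap_self, RingHom.id_apply] at hrec
      have i0 := ih n (by omega)
      have i1 := ih (n + 1) (by omega)
      -- The factor 3 closes the induction: the recurrence gives L δ² (6L + 1), at most B² = 9 L² δ²
      -- because L ≥ 1.
      set B := 3 * L * δ
      have hB : 0 ≤ B := by positivity
      have hn : (0 : ℝ) < n + 2 := by positivity
      have e1 : ‖(n : ℂ) + 2‖ = n + 2 := by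
        have := Complex.norm_natCast (n + 2)
        push_cast at this
        exact this
      have e2 : ‖2 * ((n : ℂ) + 1 + lam)‖ ≤ 2 * ((n + 2) * L) := by
        rw [norm_mul]
        have : ‖(n : ℂ) + 1 + lam‖ ≤ n + 1 + ‖lam‖ := by
          refine (norm_add_le _ _).trans ?_
          have := Complex.norm_natCast (n + 1)
          push_cast at this
          rw [this]
        have h2 : ‖(2 : ℂ)‖ = 2 := by simp
        rw [h2]
        have hn0 : (0 : ℝ) ≤ n := by positivity
        nlinarith [mul_nonneg hn0 hl]
      have e3 : ‖(n : ℂ) + 2 * lam‖ ≤ (n + 2) * L := by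
        refine (norm_add_le _ _).trans ?_
        rw [norm_mul, Complex.norm_natCast]
        have h2 : ‖(2 : ℂ)‖ = 2 := by simp
        rw [h2]
        have hn0 : (0 : ℝ) ≤ n := by positivity
        nlinarith [mul_nonneg hn0 hl]
      have key : (n + 2 : ℝ) * ‖gegSeq lam s τ (n + 2)‖ ≤ (n + 2) * B ^ (n + 2) := by
        rw [← e1, ← norm_mul, hrec, e1]
        calc _ ≤ ‖2 * ((n : ℂ) + 1 + lam)‖ * ‖s‖ * ‖gegSeq lam s τ (n + 1)‖ +
              ‖(n : ℂ) + 2 * lam‖ * ‖τ‖ * ‖gegSeq lam s τ n‖ := by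
              refine (norm_sub_le _ _).trans ?_
              simp only [norm_mul]; exact le_rfl
          _ ≤ (2 * ((n + 2) * L)) * δ * B ^ (n + 1) + ((n + 2) * L) * δ ^ 2 * B ^ n := by gcongr
          _ = (n + 2) * (B ^ n * (L * δ ^ 2 * (6 * L + 1))) := by simp only [B]; ring
          _ ≤ (n + 2) * (B ^ n * B ^ 2) := by
              gcongr
              have : B ^ 2 = L * δ ^ 2 * (9 * L) := by simp only [B]; ring
              rw [this]
              gcongr
              linarith
          _ = (n + 2) * B ^ (n + 2) := by ring
      exact le_of_mul_le_mul_left key hn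

/-- For s = τ = 1 the generating function degenerates to (1 - r) ^ (-2 lam), whose coefficients are
binomial. -/
theorem gegSeq_one_one (lam : ℂ) (n : ℕ) :
    gegSeq lam (1 : ℂ) 1 n = poch (2 * lam) n / n.factorial := by
  symm
  apply eq_gegSeq_of_rec lam 1 1 (fun n => poch (2 * lam) n / n.factorial)
  · simp [poch]
  · simp [poch]
  · intro n
    have h0 : (n.factorial : ℂ) ≠ 0 := by exact_mod_cast n.factorial_ne_zero
    have h1 : (n : ℂ) + 1 ≠ 0 := by exact_mod_cast n.succ_ne_zero
    have h2 : (n : ℂ) + 2 ≠ 0 := by exact_mod_cast (by omega : n + 2 ≠ 0)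
    have h3 : (n : ℂ) + 1 + 1 ≠ 0 := by rw [add_assoc]; norm_num; exact h2
    simp only [poch, ascPochhammer_succ_eval, Nat.factorial_succ]
    push_cast
    field_simp
    ring

/-! ### Formal series in r over ℂ[p], with the commuting derivations ∂_p and ∂_r -/

namespace PowerSeries

/-- Differentiation of the coefficients of a power series over a polynomial ring. -/
def coeffDeriv (f : PowerSeries (Polynomial ℂ)) : PowerSeries (Polynomial ℂ) :=
  PowerSeries.mk fun n => Polynomial.derivative (PowerSeries.coeff n f)

theorem coeff_coeffDeriv (f : PowerSeries (Polynomial ℂ)) (n : ℕ) :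
    coeff n (coeffDeriv f) = Polynomial.derivative (coeff n f) := coeff_mk _ _

theorem coeffDeriv_add (f g : PowerSeries (Polynomial ℂ)) :
    coeffDeriv (f + g) = coeffDeriv f + coeffDeriv g := by
  ext1 n; simp [coeff_coeffDeriv]

theorem coeffDeriv_sub (f g : PowerSeries (Polynomial ℂ)) :
    coeffDeriv (f - g) = coeffDeriv f - coeffDeriv g := by
  ext1 n; simp [coeff_coeffDeriv]

theorem coeffDeriv_mul (f g : PowerSeries (Polynomial ℂ)) :
    coeffDeriv (f * g) = coeffDeriv f * g + f * coeffDeriv g := by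
  ext1 n
  simp only [coeff_coeffDeriv, coeff_mul, map_add, map_sum, Polynomial.derivative_mul,
    Finset.sum_add_distrib]

theorem coeffDeriv_C (a : Polynomial ℂ) : coeffDeriv (C a) = C (Polynomial.derivative a) := by
  ext1 n
  rw [coeff_coeffDeriv, coeff_C, coeff_C]
  split_ifs <;> simp

theorem coeffDeriv_one : coeffDeriv 1 = 0 := by
  have := coeffDeriv_C 1
  simpa using this

theorem coeffDeriv_X : coeffDeriv X = 0 := by
  ext1 n
  rw [coeff_coeffDeriv, coeff_X]
  split_ifs <;> simp

theorem coeffDeriv_derivative (f : PowerSeries (Polynomial ℂ)) :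
    coeffDeriv (derivative (Polynomial ℂ) f) = derivative (Polynomial ℂ) (coeffDeriv f) := by
  ext1 n
  simp [coeff_coeffDeriv, coeff_derivative, Polynomial.derivative_mul]

end PowerSeries

namespace PowerSeries

/-- Uniqueness for a first-order linear equation: if E = X^(n+1) F, the lowest coefficient gives
(n+1) F(0) = 0, so the order of E can be raised indefinitely. -/
theorem eq_zero_of_mul_derivative_eq {A : Type*} [CommRing A] [IsDomain A] [CharZero A]
    {Q K E : PowerSeries A} (hQ : constantCoeff Q = 1) (hE : constantCoeff E = 0)
    (h : Q * derivative A E = K * E) : E = 0 := by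
  have key : ∀ n : ℕ, (X : PowerSeries A) ^ (n + 1) ∣ E := by
    intro n
    induction n with
    | zero => rw [zero_add, pow_one]; exact X_dvd_iff.mpr hE
    | succ n ih =>
      obtain ⟨F, rfl⟩ := ih
      have h1 : derivative A (X ^ (n + 1) * F) =
          X ^ n * (((n : PowerSeries A) + 1) * F + X * derivative A F) := by
        rw [Derivation.leibniz, Derivation.leibniz_pow, derivative_X]
        simp only [smul_eq_mul, nsmul_eq_mul, Nat.add_sub_cancel]
        push_cast
        ring
      rw [h1] at h
      have h2 : X ^ n * (Q * (((n : PowerSeries A) + 1) * F + X * derivative A F)) =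
          X ^ n * (X * (K * F)) := by
        rw [← mul_assoc, mul_comm (X ^ n), mul_assoc, h]; ring
      have h3 := mul_left_cancel₀ (pow_ne_zero n X_ne_zero) h2
      have h4 := congrArg constantCoeff h3
      simp only [map_mul, map_add, hQ, one_mul, map_natCast, map_one, constantCoeff_X, zero_mul,
        add_zero] at h4
      have h5 : constantCoeff F = 0 := by
        rcases mul_eq_zero.mp h4 with h5 | h5
        · exact absurd h5 (by exact_mod_cast n.succ_ne_zero)
        · exact h5
      obtain ⟨G, rfl⟩ := X_dvd_iff.mpr h5
      exact ⟨G, by ring⟩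
  ext1 n
  exact (X_pow_dvd_iff.mp (key n)) n (Nat.lt_succ_self n)

end PowerSeries

open PowerSeries in
theorem mul_derivative_mk_gegSeq (lam : ℂ) (s τ : Polynomial ℂ) :
    ((1 - 2 * C s * X + C τ * X ^ 2) *
      derivative (Polynomial ℂ) (PowerSeries.mk (gegSeq lam s τ)) =
      C (Polynomial.C lam) * (2 * C s - 2 * C τ * X) * PowerSeries.mk (gegSeq lam s τ)) := by
  have eL : ((1 - 2 * C s * X + C τ * X ^ 2) *
      derivative (Polynomial ℂ) (PowerSeries.mk (gegSeq lam s τ))) =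
      derivative (Polynomial ℂ) (PowerSeries.mk (gegSeq lam s τ)) -
      C (2 * s) * (X * derivative (Polynomial ℂ) (PowerSeries.mk (gegSeq lam s τ))) +
      C τ * (X * (X * derivative (Polynomial ℂ) (PowerSeries.mk (gegSeq lam s τ)))) := by
    rw [map_mul, map_ofNat]; ring
  have eR : C (Polynomial.C lam) * (2 * C s - 2 * C τ * X) * PowerSeries.mk (gegSeq lam s τ) =
      C (2 * Polynomial.C lam * s) * PowerSeries.mk (gegSeq lam s τ) -
      C (2 * Polynomial.C lam * τ) * (X * PowerSeries.mk (gegSeq lam s τ)) := by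
    simp only [map_mul, map_ofNat]; ring
  rw [eL, eR]
  ext1 n
  match n with
  | 0 =>
    simp only [map_add, map_sub, coeff_C_mul, coeff_zero_X_mul, coeff_mk,
      coeff_derivative, mul_zero, add_zero, sub_zero, zero_add, ← Polynomial.algebraMap_eq]
    push_cast
    simp only [gegSeq, map_mul, map_ofNat]
    ring
  | 1 =>
    have := gegSeq_rec lam s τ 0
    simp only [map_add, map_sub, coeff_C_mul, coeff_succ_X_mul, coeff_zero_X_mul, coeff_mk,
      coeff_derivative, mul_zero, add_zero, zero_add, ← Polynomial.algebraMap_eq] at this ⊢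
    push_cast at this ⊢
    simp only [gegSeq, map_mul, map_add, map_ofNat, map_one] at this ⊢
    linear_combination this
  | n + 2 =>
    have := gegSeq_rec lam s τ (n + 1)
    simp only [map_add, map_sub, coeff_C_mul, coeff_succ_X_mul, coeff_mk,
      coeff_derivative, ← Polynomial.algebraMap_eq] at this ⊢
    push_cast at this ⊢
    simp only [map_ofNat] at this ⊢
    linear_combination this

-- Formally G = Q^(-lam), which gives both logarithmic derivatives; only the one in r comes from the
-- recurrence. Differentiating that one in p, the defect E = Q ∂_pG + lam (∂_pQ) G satisfies Q E' =
-- (1 - lam) Q' E with E(0) = 0, so it vanishes.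
open PowerSeries in
theorem mul_coeffDeriv_mk_gegSeq (lam : ℂ) (s τ : Polynomial ℂ) :
    (1 - 2 * C s * X + C τ * X ^ 2) * coeffDeriv (PowerSeries.mk (gegSeq lam s τ)) =
      C (Polynomial.C lam) * (2 * C (Polynomial.derivative s) * X -
        C (Polynomial.derivative τ) * X ^ 2) * PowerSeries.mk (gegSeq lam s τ) := by
  have h1 := mul_derivative_mk_gegSeq lam s τ
  set G := PowerSeries.mk (gegSeq lam s τ) with hG
  set l := C (R := Polynomial ℂ) (Polynomial.C lam) with hl
  set S := C (R := Polynomial ℂ) s with hS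
  set T := C (R := Polynomial ℂ) τ with hT
  have dS : derivative (Polynomial ℂ) S = 0 := derivative_C
  have dT : derivative (Polynomial ℂ) T = 0 := derivative_C
  have dl : derivative (Polynomial ℂ) l = 0 := derivative_C
  have d2 : derivative (Polynomial ℂ) (2 : PowerSeries (Polynomial ℂ)) = 0 := by
    rw [← map_ofNat (C (R := Polynomial ℂ)), derivative_C]
  have cl : coeffDeriv l = 0 := by rw [hl, coeffDeriv_C]; simp
  have c2 : coeffDeriv 2 = 0 := by
    rw [← map_ofNat (C (R := Polynomial ℂ)), coeffDeriv_C, Polynomial.derivative_ofNat, map_zero]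
  have cS : coeffDeriv S = C (Polynomial.derivative s) := coeffDeriv_C s
  have cT : coeffDeriv T = C (Polynomial.derivative τ) := coeffDeriv_C τ
  set S' := C (R := Polynomial ℂ) (Polynomial.derivative s) with hS'
  set T' := C (R := Polynomial ℂ) (Polynomial.derivative τ) with hT'
  have dS' : derivative (Polynomial ℂ) S' = 0 := derivative_C
  have dT' : derivative (Polynomial ℂ) T' = 0 := derivative_C
  have h2 := congrArg coeffDeriv h1
  rw [← sub_eq_zero]
  refine eq_zero_of_mul_derivative_eq (Q := 1 - 2 * S * X + T * X ^ 2)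
    (K := (1 - l) * (2 * T * X - 2 * S)) ?_ ?_ ?_
  · simp
  · have : coeff 0 (coeffDeriv G) = 0 := by
      rw [coeff_coeffDeriv, hG, coeff_mk, gegSeq, Polynomial.derivative_one]
    rw [coeff_zero_eq_constantCoeff_apply] at this
    simp [this]
  · simp only [pow_two, coeffDeriv_mul, coeffDeriv_add, coeffDeriv_sub, coeffDeriv_one,
      coeffDeriv_X, cl, c2, cS, cT, coeffDeriv_derivative] at h2
    simp only [pow_two, map_sub, map_add, Derivation.leibniz, smul_eq_mul, dS, dT, dl, d2, dS',
      dT', derivative_X, derivative_one]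
    linear_combination (1 - 2 * S * X + T * X ^ 2) * h2 -
      (1 - l) * (T' * X ^ 2 - 2 * S' * X) * h1

/-! ### The hypergeometric operator acting on Gegenbauer polynomials -/

/-- The polynomial in `p` obtained from `gegSeq` by setting `s = p + q - 2 p q`, `τ = (q - p) ^ 2`,
that is `t ^ n C_n^lam(x)` with `x t = p + q - 2 p q` and `t = q - p`. -/
def gegPoly (lam q : ℂ) (n : ℕ) : Polynomial ℂ :=
  gegSeq lam (Polynomial.X + Polynomial.C q - 2 * Polynomial.X * Polynomial.C q)
    ((Polynomial.C q - Polynomial.X) ^ 2) n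

theorem eval_gegPoly (lam q p : ℂ) (n : ℕ) :
    (gegPoly lam q n).eval p = gegSeq lam (p + q - 2 * p * q) ((q - p) ^ 2) n := by
  have := map_gegSeq (Polynomial.aeval (R := ℂ) p) lam
    (Polynomial.X + Polynomial.C q - 2 * Polynomial.X * Polynomial.C q)
    ((Polynomial.C q - Polynomial.X) ^ 2) n
  simpa [gegPoly, Polynomial.aeval_def, Polynomial.eval₂_eq_eval_map] using this

/-- The differential operator `p (1 - p) d² + c (1 - 2 p) d` on polynomials. -/
def hypOp (c : ℂ) (f : Polynomial ℂ) : Polynomial ℂ :=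
  Polynomial.X * (1 - Polynomial.X) * Polynomial.derivative (Polynomial.derivative f) +
    Polynomial.C c * (1 - 2 * Polynomial.X) * Polynomial.derivative f

-- The r-part is θ(θ + 2 lam) - r(θ + 2 lam)(θ + c) with θ = r d/dr. The first-order equations turn
-- Q² times each term into a polynomial multiple of G, and these multiples cancel.
open PowerSeries in
theorem mk_gegPoly_pde (lam q : ℂ) :
    let G := PowerSeries.mk (gegPoly lam q)
    let p : PowerSeries (Polynomial ℂ) := C Polynomial.X
    let l : PowerSeries (Polynomial ℂ) := C (Polynomial.C lam)
    let c : PowerSeries (Polynomial ℂ) := C (Polynomial.C (lam + 1 / 2))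
    let d := derivative (Polynomial ℂ)
    p * (1 - p) * coeffDeriv (coeffDeriv G) + c * (1 - 2 * p) * coeffDeriv G
      + X * (X * d (d G)) + (1 + 2 * l) * (X * d G)
      - (X * (X * (X * d (d G))) + (1 + 2 * l + c) * (X * (X * d G)) + 2 * l * c * (X * G)) = 0 := by
  intro G p l c d
  have hc : c = l + C (Polynomial.C (1 / 2)) := by simp only [c, l, ← map_add]
  have hh : (2 : PowerSeries (Polynomial ℂ)) * C (Polynomial.C (1 / 2)) = 1 := by
    have e2 : (2 : PowerSeries (Polynomial ℂ)) = C (Polynomial.C 2) := by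
      rw [map_ofNat, map_ofNat]
    rw [e2, ← map_mul, ← map_mul]; norm_num
  set k : PowerSeries (Polynomial ℂ) := C (Polynomial.C (1 / 2)) with hk
  set s : Polynomial ℂ := Polynomial.X + Polynomial.C q - 2 * Polynomial.X * Polynomial.C q with hs
  set τ : Polynomial ℂ := (Polynomial.C q - Polynomial.X) ^ 2 with hτ
  set Y : PowerSeries (Polynomial ℂ) := C (Polynomial.C q) with hY
  have hr := mul_derivative_mk_gegSeq lam s τ
  have hp := mul_coeffDeriv_mk_gegSeq lam s τ
  have hG : PowerSeries.mk (gegSeq lam s τ) = G := rfl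
  have es : C s = p + Y - 2 * p * Y := by
    simp only [hs, map_add, map_sub, map_mul, map_ofNat, p, hY]
  have et : C τ = (Y - p) ^ 2 := by simp only [hτ, map_pow, map_sub, p, hY]
  have es' : C (Polynomial.derivative s) = 1 - 2 * Y := by
    have : Polynomial.derivative s = 1 - 2 * Polynomial.C q := by
      simp [hs, Polynomial.derivative_mul]
    rw [this]; simp only [map_one, map_sub, map_mul, map_ofNat, hY]
  have et' : C (Polynomial.derivative τ) = 2 * (p - Y) := by
    have : Polynomial.derivative τ = 2 * (Polynomial.X - Polynomial.C q) := by
      simp only [hτ, pow_two, Polynomial.derivative_mul, Polynomial.derivative_sub,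
        Polynomial.derivative_C, Polynomial.derivative_X]
      ring
    rw [this]; simp only [map_sub, map_mul, map_ofNat, hY, p]
  rw [hG, es, et] at hr
  rw [hG, es, et, es', et'] at hp
  have dp : derivative (Polynomial ℂ) p = 0 := derivative_C
  have dY : derivative (Polynomial ℂ) Y = 0 := derivative_C
  have dl : derivative (Polynomial ℂ) (C (Polynomial.C lam)) = 0 := derivative_C
  have d2 : derivative (Polynomial ℂ) (2 : PowerSeries (Polynomial ℂ)) = 0 := by
    rw [← map_ofNat (C (R := Polynomial ℂ)), derivative_C]
  have cl : coeffDeriv (C (Polynomial.C lam)) = 0 := by rw [coeffDeriv_C]; simp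
  have cY : coeffDeriv Y = 0 := by rw [hY, coeffDeriv_C]; simp
  have cp : coeffDeriv p = 1 := by simp only [p]; rw [coeffDeriv_C]; simp
  have c2 : coeffDeriv 2 = 0 := by
    rw [← map_ofNat (C (R := Polynomial ℂ)), coeffDeriv_C, Polynomial.derivative_ofNat, map_zero]
  have hrr := congrArg (derivative (Polynomial ℂ)) hr
  have hpp := congrArg coeffDeriv hp
  simp only [pow_two, map_sub, map_add, Derivation.leibniz, smul_eq_mul, dp, dY, dl, d2,
      derivative_X, derivative_one] at hrr
  simp only [pow_two, coeffDeriv_mul, coeffDeriv_add, coeffDeriv_sub, coeffDeriv_one,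
      coeffDeriv_X, cl, c2, cY, cp] at hpp
  rw [hc]
  set Q := 1 - 2 * (p + Y - 2 * p * Y) * X + (Y - p) ^ 2 * X ^ 2 with hQ
  have hQ0 : Q ^ 2 ≠ 0 := by
    apply pow_ne_zero
    intro h
    have := congrArg constantCoeff h
    simp [hQ] at this
  apply mul_left_cancel₀ hQ0
  rw [mul_zero]
  have Hp : Q * coeffDeriv G = -(l * (2 * (p - Y) * X ^ 2 - 2 * (1 - 2 * Y) * X) * G) := by
    linear_combination hp
  have Hr : Q * d G = -(l * (2 * (Y - p) ^ 2 * X - 2 * (p + Y - 2 * p * Y)) * G) := by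
    linear_combination hr
  have Hpp : (2 * (p - Y) * X ^ 2 - 2 * (1 - 2 * Y) * X) * coeffDeriv G * (1 + l) +
      Q * coeffDeriv (coeffDeriv G) + 2 * l * X ^ 2 * G = 0 := by
    simp only [hQ]
    linear_combination hpp
  have Hrr : (2 * (Y - p) ^ 2 * X - 2 * (p + Y - 2 * p * Y)) * d G * (1 + l) +
      Q * d (d G) + 2 * l * (Y - p) ^ 2 * G = 0 := by
    simp only [hQ]
    linear_combination hrr
  generalize coeffDeriv (coeffDeriv G) = Gpp at *
  generalize coeffDeriv G = Gp at *
  generalize d (d G) = Grr at *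
  generalize d G = Gr at *
  clear hr hp hrr hpp
  have key : p * (1 - p) * (Q ^ 2 * Gpp) + (l + k) * (1 - 2 * p) * Q * (Q * Gp) +
      (X ^ 2 - X ^ 3) * (Q ^ 2 * Grr) +
      ((1 + 2 * l) * X - (1 + 2 * l + (l + k)) * X ^ 2) * Q * (Q * Gr) -
      2 * l * (l + k) * X * Q ^ 2 * G = 0 := by
    have e1 : Q ^ 2 * Gpp = ((1 + l) * l * (2 * (p - Y) * X ^ 2 - 2 * (1 - 2 * Y) * X) ^ 2 -
        2 * l * X ^ 2 * Q) * G := by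
      linear_combination Q * Hpp -
        (1 + l) * (2 * (p - Y) * X ^ 2 - 2 * (1 - 2 * Y) * X) * Hp
    have e2 : Q ^ 2 * Grr = ((1 + l) * l * (2 * (Y - p) ^ 2 * X - 2 * (p + Y - 2 * p * Y)) ^ 2 -
        2 * l * (Y - p) ^ 2 * Q) * G := by
      linear_combination Q * Hrr -
        (1 + l) * (2 * (Y - p) ^ 2 * X - 2 * (p + Y - 2 * p * Y)) * Hr
    rw [e1, e2, Hp, Hr]
    -- `ring` sees `k` as an atom, so 2k = 1 enters with the cofactor of k in the identity.
    have hh' : k * 2 = 1 := by rw [mul_comm]; exact hh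
    simp only [hQ]
    linear_combination (-(p * (1 - p) *
        ((1 + l) * l * (2 * (p - Y) * X ^ 2 - 2 * (1 - 2 * Y) * X) ^ 2 - 2 * l * X ^ 2 * Q) -
      l * (1 - 2 * p) * Q * (l * (2 * (p - Y) * X ^ 2 - 2 * (1 - 2 * Y) * X)) +
      (X ^ 2 - X ^ 3) * ((1 + l) * l * (2 * (Y - p) ^ 2 * X - 2 * (p + Y - 2 * p * Y)) ^ 2 -
        2 * l * (Y - p) ^ 2 * Q) -
      ((1 + 2 * l) * X - (1 + 2 * l + l) * X ^ 2) * Q *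
        (l * (2 * (Y - p) ^ 2 * X - 2 * (p + Y - 2 * p * Y))) -
      2 * l * l * X * Q ^ 2) * G) * hh'
  linear_combination key

open PowerSeries in
theorem hypOp_gegPoly_succ (lam q : ℂ) (n : ℕ) :
    hypOp (lam + 1 / 2) (gegPoly lam q (n + 1)) =
      Polynomial.C (-((n + 1) * (n + 1 + 2 * lam))) * gegPoly lam q (n + 1) +
        Polynomial.C ((2 * lam + n) * (lam + 1 / 2 + n)) * gegPoly lam q n := by
  -- The coefficients are kept opaque so that each `C aᵢ` stays a single scalar during coefficient
  -- extraction.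
  obtain ⟨a₁, h₁⟩ : ∃ a : Polynomial ℂ, a = Polynomial.X * (1 - Polynomial.X) := ⟨_, rfl⟩
  obtain ⟨a₂, h₂⟩ : ∃ a : Polynomial ℂ,
    a = Polynomial.C (lam + 1 / 2) * (1 - 2 * Polynomial.X) := ⟨_, rfl⟩
  obtain ⟨a₃, h₃⟩ : ∃ a : Polynomial ℂ, a = 1 + 2 * Polynomial.C lam := ⟨_, rfl⟩
  obtain ⟨a₄, h₄⟩ : ∃ a : Polynomial ℂ,
    a = 1 + 2 * Polynomial.C lam + Polynomial.C (lam + 1 / 2) := ⟨_, rfl⟩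
  obtain ⟨a₅, h₅⟩ : ∃ a : Polynomial ℂ,
    a = 2 * Polynomial.C lam * Polynomial.C (lam + 1 / 2) := ⟨_, rfl⟩
  have h0 := mk_gegPoly_pde lam q
  generalize gegPoly lam q = g at h0 ⊢
  have h : C a₁ * coeffDeriv (coeffDeriv (PowerSeries.mk g)) + C a₂ * coeffDeriv (PowerSeries.mk g)
      + X * (X * derivative (Polynomial ℂ) (derivative (Polynomial ℂ) (PowerSeries.mk g)))
      + C a₃ * (X * derivative (Polynomial ℂ) (PowerSeries.mk g))
      - (X * (X * (X * derivative (Polynomial ℂ) (derivative (Polynomial ℂ) (PowerSeries.mk g))))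
        + C a₄ * (X * (X * derivative (Polynomial ℂ) (PowerSeries.mk g)))
        + C a₅ * (X * PowerSeries.mk g)) = 0 := by
    rw [h₁, h₂, h₃, h₄, h₅, ← h0]
    simp only [map_add (C (R := Polynomial ℂ)), map_sub, map_mul, map_one, map_ofNat]
  clear h0
  replace h := congrArg (coeff (n + 1)) h
  simp only [map_add, map_sub, coeff_C_mul, coeff_succ_X_mul, coeff_coeffDeriv, map_zero,
    coeff_mk] at h
  rcases n with _ | _ | n
  · simp only [coeff_zero_X_mul, coeff_derivative, coeff_mk] at h
    subst h₁ h₂ h₃ h₄ h₅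
    simp only [hypOp, map_add, map_mul, map_neg, map_ofNat, map_natCast, map_one] at h ⊢
    push_cast at h ⊢
    linear_combination h
  · simp only [coeff_succ_X_mul, coeff_zero_X_mul, coeff_derivative, coeff_mk] at h
    subst h₁ h₂ h₃ h₄ h₅
    simp only [hypOp, map_add, map_mul, map_neg, map_ofNat, map_natCast, map_one] at h ⊢
    push_cast at h ⊢
    linear_combination h
  · simp only [coeff_succ_X_mul, coeff_derivative, coeff_mk] at h
    subst h₁ h₂ h₃ h₄ h₅
    simp only [hypOp, map_add, map_mul, map_neg, map_ofNat, map_natCast, map_one] at h ⊢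
    push_cast at h ⊢
    linear_combination h

/-! ### Coefficients of the series and its partial sums -/

theorem poch_zero (a : ℂ) : poch a 0 = 1 := by simp [poch]

theorem poch_succ (a : ℂ) (n : ℕ) : poch a (n + 1) = poch a n * (a + n) := by
  simp [poch, ascPochhammer_succ_eval]

theorem poch_ne_zero {a : ℂ} (h : ∀ n : ℕ, a + n ≠ 0) (n : ℕ) : poch a n ≠ 0 := by
  induction n with
  | zero => simp [poch_zero]
  | succ n ih => rw [poch_succ]; exact mul_ne_zero ih (h n)

/-- The coefficient `(a)_n (b)_n / ((2 lam)_n (lam + 1/2)_n)`. -/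
def genCoeff (lam a b : ℂ) (n : ℕ) : ℂ :=
  poch a n * poch b n / (poch (2 * lam) n * poch (lam + 1 / 2) n)

theorem genCoeff_zero (lam a b : ℂ) : genCoeff lam a b 0 = 1 := by simp [genCoeff, poch_zero]

theorem genCoeff_succ {lam : ℂ} (a b : ℂ) (h2 : ∀ n : ℕ, 2 * lam + n ≠ 0)
    (hc : ∀ n : ℕ, lam + 1 / 2 + n ≠ 0) (n : ℕ) :
    genCoeff lam a b (n + 1) =
      genCoeff lam a b n * ((a + n) / (2 * lam + n) * ((b + n) / (lam + 1 / 2 + n))) := by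
  have := h2 n
  have := hc n
  have := poch_ne_zero h2 n
  have := poch_ne_zero hc n
  simp only [genCoeff, poch_succ]
  field_simp

theorem exists_norm_add_div_add_le (a b : ℂ) :
    ∃ K : ℝ, 1 ≤ K ∧ ∀ n : ℕ, ‖(a + n) / (b + n)‖ ≤ K := by
  have h : Filter.Tendsto (fun n : ℕ => (a + n) / (b + n)) Filter.atTop (𝓝 1) := by
    have h1 := tendsto_const_div_atTop_nhds_zero_nat a
    have h2 := tendsto_const_div_atTop_nhds_zero_nat b
    have h3 := (h1.add_const 1).div (h2.add_const 1) (by simp)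
    simp only [zero_add, div_one] at h3
    refine h3.congr' ?_
    filter_upwards [Filter.eventually_gt_atTop 0] with n hn
    have : (n : ℂ) ≠ 0 := by exact_mod_cast hn.ne'
    simp only [Pi.div_apply]
    rw [← mul_div_mul_right _ _ this, add_mul, add_mul, div_mul_cancel₀ _ this,
      div_mul_cancel₀ _ this, one_mul]
  obtain ⟨K, hK⟩ := h.norm.bddAbove_range
  exact ⟨max K 1, le_max_right _ _, fun n => (hK ⟨n, rfl⟩).trans (le_max_left _ _)⟩

theorem exists_norm_genCoeff_le {lam : ℂ} (a b : ℂ) (h2 : ∀ n : ℕ, 2 * lam + n ≠ 0)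
    (hc : ∀ n : ℕ, lam + 1 / 2 + n ≠ 0) :
    ∃ ρ : ℝ, 1 ≤ ρ ∧ ∀ n : ℕ, ‖genCoeff lam a b n‖ ≤ ρ ^ n := by
  obtain ⟨K, hK1, hK⟩ := exists_norm_add_div_add_le a (2 * lam)
  obtain ⟨M, hM1, hM⟩ := exists_norm_add_div_add_le b (lam + 1 / 2)
  refine ⟨K * M, one_le_mul_of_one_le_of_one_le hK1 hM1, fun n => ?_⟩
  induction n with
  | zero => simp [genCoeff_zero]
  | succ n ih =>
    rw [genCoeff_succ a b h2 hc, norm_mul, norm_mul, pow_succ]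
    have := hK n
    have := hM n
    gcongr

/-- Partial sums of the generating function. -/
def genPartial (lam a b q : ℂ) (N : ℕ) : Polynomial ℂ :=
  ∑ n ∈ Finset.range N, Polynomial.C (genCoeff lam a b n) * gegPoly lam q n

theorem hypOp_add (c : ℂ) (f g : Polynomial ℂ) : hypOp c (f + g) = hypOp c f + hypOp c g := by
  simp only [hypOp, map_add]; ring

theorem hypOp_C_mul (c k : ℂ) (f : Polynomial ℂ) :
    hypOp c (Polynomial.C k * f) = Polynomial.C k * hypOp c f := by
  simp only [hypOp, Polynomial.derivative_C_mul]; ring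

/-- Telescoping: genCoeff_{n+1} (2 lam + n)(c + n) = (a+n)(b+n) genCoeff_n, while a + b = 2 lam
gives ab - (a+n)(b+n) = -n(n + 2 lam). Only the last term survives. -/
theorem hypOp_genPartial {lam a b : ℂ} (hab : a + b = 2 * lam) (h2 : ∀ n : ℕ, 2 * lam + n ≠ 0)
    (hc : ∀ n : ℕ, lam + 1 / 2 + n ≠ 0) (q : ℂ) (N : ℕ) :
    hypOp (lam + 1 / 2) (genPartial lam a b q (N + 1)) =
      Polynomial.C (a * b) * genPartial lam a b q (N + 1) -
        Polynomial.C ((a + N) * (b + N) * genCoeff lam a b N) * gegPoly lam q N := by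
  induction N with
  | zero => simp [genPartial, genCoeff_zero, gegPoly, gegSeq, hypOp]
  | succ N ih =>
    have e : genPartial lam a b q (N + 1 + 1) = genPartial lam a b q (N + 1) +
        Polynomial.C (genCoeff lam a b (N + 1)) * gegPoly lam q (N + 1) := by
      rw [genPartial, Finset.sum_range_succ, genPartial]
    rw [e, hypOp_add, hypOp_C_mul, ih, hypOp_gegPoly_succ]
    have e1 : genCoeff lam a b (N + 1) * ((2 * lam + N) * (lam + 1 / 2 + N)) =
        (a + N) * (b + N) * genCoeff lam a b N := by
      rw [genCoeff_succ a b h2 hc, mul_assoc, mul_mul_mul_comm, div_mul_cancel₀ _ (h2 N),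
        div_mul_cancel₀ _ (hc N), mul_comm]
    have e2 : genCoeff lam a b (N + 1) * -((N + 1) * (N + 1 + 2 * lam)) =
        a * b * genCoeff lam a b (N + 1) -
          (a + (N + 1 : ℕ)) * (b + (N + 1 : ℕ)) * genCoeff lam a b (N + 1) := by
      rw [← hab]; push_cast; ring
    have e1' := congrArg (Polynomial.C (R := ℂ)) e1
    have e2' := congrArg (Polynomial.C (R := ℂ)) e2
    rw [Polynomial.C_mul] at e1'
    rw [Polynomial.C_mul, Polynomial.C_sub, Polynomial.C_mul (a := a * b)] at e2'
    linear_combination gegPoly lam q N * e1' + gegPoly lam q (N + 1) * e2'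

/-! ### Convergence and the differential equation -/

/-- The sum of the generating function in the variables `p = (1 - R - t) / 2`,
`q = (1 - R + t) / 2`. -/
def genFun (lam a b q p : ℂ) : ℂ := ∑' n, genCoeff lam a b n * (gegPoly lam q n).eval p

/-- `f` is differentiable on the disk of radius `δ` around `0` and solves
`p (1 - p) f'' + c (1 - 2 p) f' = κ f` there. -/
def SolvesHyp (c κ : ℂ) (δ : ℝ) (f : ℂ → ℂ) : Prop :=
  DifferentiableOn ℂ f (Metric.ball 0 δ) ∧ ∀ p ∈ Metric.ball (0 : ℂ) δ,
    p * (1 - p) * deriv (deriv f) p + c * (1 - 2 * p) * deriv f p = κ * f p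

/-- Locally uniform convergence of holomorphic functions permits two termwise differentiations, and
the leftover term of the partial sums is O(N² 2^(-N)). The radius serves all q at once. -/
theorem exists_radius_genFun {lam a b : ℂ} (hab : a + b = 2 * lam)
    (h2 : ∀ n : ℕ, 2 * lam + n ≠ 0) (hc : ∀ n : ℕ, lam + 1 / 2 + n ≠ 0) :
    ∃ δ : ℝ, 0 < δ ∧ ∀ q ∈ Metric.ball (0 : ℂ) δ,
      (∀ p ∈ Metric.ball (0 : ℂ) δ,
        HasSum (fun n => genCoeff lam a b n * (gegPoly lam q n).eval p) (genFun lam a b q p)) ∧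
      SolvesHyp (lam + 1 / 2) (a * b) δ (genFun lam a b q) := by
  obtain ⟨ρ, hρ1, hρ⟩ := exists_norm_genCoeff_le a b h2 hc
  have hl := norm_nonneg lam
  set L := 1 + 2 * ‖lam‖ with hL
  have hL1 : 1 ≤ L := by linarith
  have hρL : 1 ≤ ρ * L := one_le_mul_of_one_le_of_one_le hρ1 hL1
  -- With |s| ≤ 4δ and |τ| ≤ (4δ)², the terms are at most (ρ · 3L · 4δ)^n = 2^(-n).
  set δ : ℝ := 1 / (24 * (ρ * L)) with hδ
  have hδ0 : 0 < δ := by positivity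
  have hδ1 : δ ≤ 1 := by
    rw [hδ, div_le_one (by positivity)]; linarith
  have hδe : ρ * (3 * L * (4 * δ)) = 1 / 2 := by
    rw [hδ]
    have : ρ ≠ 0 := by positivity
    have : L ≠ 0 := by positivity
    field_simp
    norm_num
  refine ⟨δ, hδ0, fun q hq => ?_⟩
  rw [mem_ball_zero_iff] at hq
  have bound : ∀ n : ℕ, ∀ p ∈ Metric.ball (0 : ℂ) δ,
      ‖genCoeff lam a b n * (gegPoly lam q n).eval p‖ ≤ (1 / 2 : ℝ) ^ n := by
    intro n p hp
    rw [mem_ball_zero_iff] at hp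
    have hs : ‖p + q - 2 * p * q‖ ≤ 4 * δ := by
      calc ‖p + q - 2 * p * q‖ ≤ ‖p‖ + ‖q‖ + 2 * ‖p‖ * ‖q‖ := by
            refine (norm_sub_le _ _).trans ?_
            have : ‖2 * p * q‖ = 2 * ‖p‖ * ‖q‖ := by simp
            rw [this]
            gcongr
            exact norm_add_le _ _
        _ ≤ δ + δ + 2 * 1 * δ := by
            gcongr
            exact hp.le.trans hδ1
        _ = 4 * δ := by ring
    have ht : ‖(q - p) ^ 2‖ ≤ (4 * δ) ^ 2 := by
      rw [norm_pow]
      gcongr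
      refine (norm_sub_le _ _).trans ?_
      linarith
    rw [eval_gegPoly, norm_mul, ← hδe, mul_pow]
    have h3 := norm_gegSeq_le (lam := lam) hs ht n
    have h4 := hρ n
    gcongr
  have hsum : ∀ p ∈ Metric.ball (0 : ℂ) δ,
      HasSum (fun n => genCoeff lam a b n * (gegPoly lam q n).eval p) (genFun lam a b q p) :=
    fun p hp => (Summable.of_norm_bounded summable_geometric_two (bound · p hp)).hasSum
  have hpart : ∀ N p, (genPartial lam a b q N).eval p =
      ∑ n ∈ Finset.range N, genCoeff lam a b n * (gegPoly lam q n).eval p := by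
    intro N p
    simp [genPartial, Polynomial.eval_finsetSum]
  have hO : IsOpen (Metric.ball (0 : ℂ) δ) := Metric.isOpen_ball
  have u0 : TendstoLocallyUniformlyOn (fun N p => (genPartial lam a b q N).eval p)
      (genFun lam a b q) Filter.atTop (Metric.ball 0 δ) := by
    have := (tendstoUniformlyOn_tsum_nat summable_geometric_two bound).tendstoLocallyUniformlyOn
    simp only [hpart]
    exact this
  have u1 : TendstoLocallyUniformlyOn
      (fun N p => (Polynomial.derivative (genPartial lam a b q N)).eval p)
      (deriv (genFun lam a b q)) Filter.atTop (Metric.ball 0 δ) := by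
    have := u0.deriv (Filter.Eventually.of_forall fun N =>
      (genPartial lam a b q N).differentiable.differentiableOn) hO
    have e : (deriv ∘ fun N p => (genPartial lam a b q N).eval p) =
      (fun N p => (Polynomial.derivative (genPartial lam a b q N)).eval p) := by
      funext N p; simp
    rwa [e] at this
  have u2 : TendstoLocallyUniformlyOn
      (fun N p =>
        (Polynomial.derivative (Polynomial.derivative (genPartial lam a b q N))).eval p)
      (deriv (deriv (genFun lam a b q))) Filter.atTop (Metric.ball 0 δ) := by
    have := u1.deriv (Filter.Eventually.of_forall fun N =>
      (Polynomial.derivative (genPartial lam a b q N)).differentiable.differentiableOn) hO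
    have e : (deriv ∘ fun N p => (Polynomial.derivative (genPartial lam a b q N)).eval p) =
      (fun N p =>
        (Polynomial.derivative (Polynomial.derivative (genPartial lam a b q N))).eval p) := by
      funext N p; simp
    rwa [e] at this
  refine ⟨hsum, u0.differentiableOn (Filter.Eventually.of_forall fun N =>
      (genPartial lam a b q N).differentiable.differentiableOn) hO, fun p hp => ?_⟩
  have t0 := u0.tendsto_at hp
  have t1 := u1.tendsto_at hp
  have t2 := u2.tendsto_at hp
  have tL : Filter.Tendsto (fun N => (hypOp (lam + 1 / 2) (genPartial lam a b q N)).eval p)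
      Filter.atTop (𝓝 (p * (1 - p) * deriv (deriv (genFun lam a b q)) p +
        (lam + 1 / 2) * (1 - 2 * p) * deriv (genFun lam a b q) p)) := by
    have := (t2.const_mul (p * (1 - p))).add (t1.const_mul ((lam + 1 / 2) * (1 - 2 * p)))
    refine this.congr fun N => ?_
    simp [hypOp]
  have tE : Filter.Tendsto (fun N : ℕ => (a + N) * (b + N) *
      (genCoeff lam a b N * (gegPoly lam q N).eval p)) Filter.atTop (𝓝 0) := by
    have hr := fun k => tendsto_pow_const_mul_const_pow_of_abs_lt_one k
      (r := (1 / 2 : ℝ)) (by norm_num [abs_of_pos])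
    have hmaj : Filter.Tendsto (fun N : ℕ => ‖a‖ * ‖b‖ * ((N : ℝ) ^ 0 * (1 / 2) ^ N) +
        (‖a‖ + ‖b‖) * ((N : ℝ) ^ 1 * (1 / 2) ^ N) + (N : ℝ) ^ 2 * (1 / 2) ^ N)
        Filter.atTop (𝓝 0) := by
      have := (((hr 0).const_mul (‖a‖ * ‖b‖)).add ((hr 1).const_mul (‖a‖ + ‖b‖))).add (hr 2)
      simpa using this
    refine squeeze_zero_norm (fun N => ?_) hmaj
    rw [norm_mul, norm_mul]
    have i1 : ‖a + N‖ ≤ ‖a‖ + N := (norm_add_le _ _).trans (by simp)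
    have i2 : ‖b + N‖ ≤ ‖b‖ + N := (norm_add_le _ _).trans (by simp)
    have i3 := bound N p hp
    calc _ ≤ (‖a‖ + N) * (‖b‖ + N) * (1 / 2) ^ N := by gcongr
      _ = _ := by ring
  have tR : Filter.Tendsto (fun N => (hypOp (lam + 1 / 2) (genPartial lam a b q (N + 1))).eval p)
      Filter.atTop (𝓝 (a * b * genFun lam a b q p)) := by
    have := (((Filter.tendsto_add_atTop_iff_nat 1).mpr t0).const_mul (a * b)).sub tE
    rw [sub_zero] at this
    refine this.congr fun N => ?_
    rw [hypOp_genPartial hab h2 hc]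
    simp only [Polynomial.eval_sub, Polynomial.eval_mul, Polynomial.eval_C]
    ring
  exact tendsto_nhds_unique ((Filter.tendsto_add_atTop_iff_nat 1).mpr tL) tR

/-! ### Uniqueness of the solution analytic at 0 -/

theorem SolvesHyp.analyticOnNhd {c κ : ℂ} {δ : ℝ} {f : ℂ → ℂ} (hf : SolvesHyp c κ δ f) :
    AnalyticOnNhd ℂ f (Metric.ball 0 δ) := hf.1.analyticOnNhd Metric.isOpen_ball

theorem SolvesHyp.sub {c κ : ℂ} {δ : ℝ} {f g : ℂ → ℂ} (hf : SolvesHyp c κ δ f)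
    (hg : SolvesHyp c κ δ g) : SolvesHyp c κ δ (fun p => f p - g p) := by
  refine ⟨hf.1.sub hg.1, fun p hp => ?_⟩
  have h1 : ∀ z ∈ Metric.ball (0 : ℂ) δ, deriv (fun p => f p - g p) z = deriv f z - deriv g z :=
    fun z hz => deriv_fun_sub (hf.analyticOnNhd z hz).differentiableAt
      (hg.analyticOnNhd z hz).differentiableAt
  have h2 : deriv (fun p => f p - g p) =ᶠ[𝓝 p] fun z => deriv f z - deriv g z :=
    Filter.eventually_of_mem (Metric.isOpen_ball.mem_nhds hp) h1
  rw [h2.deriv_eq, h1 p hp, deriv_fun_sub (hf.analyticOnNhd p hp).deriv.differentiableAt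
      (hg.analyticOnNhd p hp).deriv.differentiableAt]
  linear_combination hf.2 p hp - hg.2 p hp

theorem SolvesHyp.const_mul {c κ : ℂ} {δ : ℝ} {f : ℂ → ℂ} (hf : SolvesHyp c κ δ f) (k : ℂ) :
    SolvesHyp c κ δ (fun p => k * f p) := by
  refine ⟨hf.1.const_mul k, fun p hp => ?_⟩
  have h1 : ∀ z ∈ Metric.ball (0 : ℂ) δ, deriv (fun p => k * f p) z = k * deriv f z :=
    fun z hz => deriv_const_mul k (hf.analyticOnNhd z hz).differentiableAt
  have h2 : deriv (fun p => k * f p) =ᶠ[𝓝 p] fun z => k * deriv f z :=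
    Filter.eventually_of_mem (Metric.isOpen_ball.mem_nhds hp) h1
  rw [h2.deriv_eq, h1 p hp, deriv_const_mul k (hf.analyticOnNhd p hp).deriv.differentiableAt]
  linear_combination k * hf.2 p hp

theorem SolvesHyp.mono {c κ : ℂ} {δ ε : ℝ} {f : ℂ → ℂ} (hf : SolvesHyp c κ δ f) (h : ε ≤ δ) :
    SolvesHyp c κ ε f :=
  ⟨hf.1.mono (Metric.ball_subset_ball h), fun p hp => hf.2 p (Metric.ball_subset_ball h hp)⟩

/-- The extra factor z avoids the exponent k - 1, which would be truncated at k = 0. -/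
theorem mul_deriv_pow_mul {h : ℂ → ℂ} {z : ℂ} (k : ℕ) (hh : AnalyticAt ℂ h z) :
    z * deriv (fun z => z ^ k * h z) z = z ^ k * (k * h z + z * deriv h z) := by
  have := ((hasDerivAt_pow k z).fun_mul hh.differentiableAt.hasDerivAt).deriv
  rw [this]
  rcases k with _ | k
  · simp
  · rw [Nat.add_sub_cancel]; push_cast; ring

/-- Indicial argument: if f = z^(k+1) g with g(0) ≠ 0, the lowest-order term of the equation is
(k+1)(c+k) g(0), which is nonzero. -/
theorem SolvesHyp.eq_zero {c κ : ℂ} {δ : ℝ} {f : ℂ → ℂ} (hδ : 0 < δ) (hc : ∀ n : ℕ, c + n ≠ 0)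
    (hf : SolvesHyp c κ δ f) (h0 : f 0 = 0) : ∀ p ∈ Metric.ball (0 : ℂ) δ, f p = 0 := by
  have m0 : (0 : ℂ) ∈ Metric.ball (0 : ℂ) δ := Metric.mem_ball_self hδ
  refine fun p hp => hf.analyticOnNhd.eqOn_zero_of_preconnected_of_eventuallyEq_zero
    (convex_ball _ _).isPreconnected m0 ?_ hp
  by_contra hne
  obtain ⟨m, g, hg, hg0, hfg⟩ :=
    (hf.analyticOnNhd 0 m0).exists_eventuallyEq_pow_smul_nonzero_iff.mpr hne
  simp only [sub_zero, smul_eq_mul] at hfg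
  rcases m with _ | k
  · have := hfg.self_of_nhds
    rw [h0, pow_zero, one_mul] at this
    exact hg0 this.symm
  set h : ℂ → ℂ := fun z => (k + 1) * g z + z * deriv g z with hh
  have hha : AnalyticAt ℂ h 0 := (analyticAt_const.mul hg).add (analyticAt_id.mul hg.deriv)
  have hd1 : deriv f =ᶠ[𝓝 0] fun z => z ^ k * h z := by
    filter_upwards [hfg.eventually_nhds, hg.eventually_analyticAt] with z hz hgz
    have hz' : f =ᶠ[𝓝 z] fun z => z ^ (k + 1) * g z := hz
    rw [hz'.deriv_eq,
      ((hasDerivAt_pow (k + 1) z).fun_mul hgz.differentiableAt.hasDerivAt).deriv,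
      Nat.add_sub_cancel, hh]
    push_cast
    ring
  have hd2 : ∀ᶠ z in 𝓝 (0 : ℂ), z * deriv (deriv f) z = z ^ k * (k * h z + z * deriv h z) := by
    filter_upwards [hd1.eventually_nhds, hha.eventually_analyticAt] with z hz hhz
    have hz' : deriv f =ᶠ[𝓝 z] fun z => z ^ k * h z := hz
    rw [hz'.deriv_eq, mul_deriv_pow_mul k hhz]
  -- The equation divided by z^k: it holds off 0, hence at 0 by continuity.
  set B : ℂ → ℂ := fun z => (1 - z) * (k * h z + z * deriv h z) + c * (1 - 2 * z) * h z -
    κ * (z * g z) with hB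
  have hBa : ContinuousAt B 0 := by
    have h1 := hha.continuousAt
    have h2 := hha.deriv.continuousAt
    have h3 := hg.continuousAt
    fun_prop
  have hBz : ∀ᶠ z in 𝓝[≠] (0 : ℂ), B z = 0 := by
    filter_upwards [hfg.filter_mono nhdsWithin_le_nhds, hd1.filter_mono nhdsWithin_le_nhds,
      hd2.filter_mono nhdsWithin_le_nhds, self_mem_nhdsWithin,
      nhdsWithin_le_nhds (Metric.isOpen_ball.mem_nhds m0)] with z e0 e1 e2 hz hzb
    have := hf.2 z hzb
    have hzk : z ^ k ≠ 0 := pow_ne_zero k hz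
    apply (mul_eq_zero.mp _).resolve_left hzk
    rw [e0, e1] at this
    simp only [hB]
    linear_combination this - (1 - z) * e2
  have hB0 : B 0 = 0 := by
    have t1 : Filter.Tendsto B (𝓝[≠] 0) (𝓝 (B 0)) := hBa.tendsto.mono_left nhdsWithin_le_nhds
    have t2 : Filter.Tendsto B (𝓝[≠] 0) (𝓝 0) :=
      tendsto_const_nhds.congr' (hBz.mono fun z hz => hz.symm)
    exact tendsto_nhds_unique t1 t2
  have hk : (k : ℂ) + 1 ≠ 0 := by exact_mod_cast k.succ_ne_zero
  have : (c + k) * ((k + 1) * g 0) = 0 := by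
    simp only [hB, hh] at hB0
    linear_combination hB0
  exact mul_ne_zero (hc k) (mul_ne_zero hk hg0) this

theorem SolvesHyp.eq_of_eq_zero {c κ : ℂ} {δ : ℝ} {f g : ℂ → ℂ} (hδ : 0 < δ)
    (hc : ∀ n : ℕ, c + n ≠ 0) (hf : SolvesHyp c κ δ f) (hg : SolvesHyp c κ δ g)
    (h0 : f 0 = g 0) : ∀ p ∈ Metric.ball (0 : ℂ) δ, f p = g p :=
  fun p hp => sub_eq_zero.mp
    ((hf.sub hg).eq_zero hδ hc (sub_eq_zero.mpr h0) p hp)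

/-! ### Factorization of the sum -/

theorem genCoeff_mul_gegSeq_one {lam : ℂ} (a b : ℂ) (h2 : ∀ n : ℕ, 2 * lam + n ≠ 0) (n : ℕ) :
    genCoeff lam a b n * gegSeq lam (1 : ℂ) 1 n =
      (n.factorial : ℂ)⁻¹ * poch a n * poch b n * (poch (lam + 1 / 2) n)⁻¹ := by
  have := poch_ne_zero h2 n
  rw [gegSeq_one_one, genCoeff]
  field_simp

theorem tsum_genCoeff_gegSeq_one {lam : ℂ} (a b : ℂ) (h2 : ∀ n : ℕ, 2 * lam + n ≠ 0) (p : ℂ) :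
    ∑' n, genCoeff lam a b n * gegSeq lam p (p ^ 2) n =
      ordinaryHypergeometric a b (lam + 1 / 2) p := by
  rw [ordinaryHypergeometric_eq_tsum]
  refine tsum_congr fun n => ?_
  have := gegSeq_mul_sq lam 1 p 1 n
  rw [one_mul, one_mul] at this
  rw [this, ← mul_assoc, genCoeff_mul_gegSeq_one a b h2]
  rfl

theorem genFun_zero_left {lam : ℂ} (a b : ℂ) (h2 : ∀ n : ℕ, 2 * lam + n ≠ 0) (p : ℂ) :
    genFun lam a b 0 p = ordinaryHypergeometric a b (lam + 1 / 2) p := by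
  rw [← tsum_genCoeff_gegSeq_one a b h2]
  simp only [genFun, eval_gegPoly]
  refine tsum_congr fun n => ?_
  congr 2 <;> ring

theorem genFun_zero_right {lam : ℂ} (a b : ℂ) (h2 : ∀ n : ℕ, 2 * lam + n ≠ 0) (q : ℂ) :
    genFun lam a b q 0 = ordinaryHypergeometric a b (lam + 1 / 2) q := by
  rw [← tsum_genCoeff_gegSeq_one a b h2]
  simp only [genFun, eval_gegPoly]
  refine tsum_congr fun n => ?_
  congr 2 <;> ring

theorem exists_radius_hypergeometric {lam a b : ℂ} (hab : a + b = 2 * lam)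
    (h2 : ∀ n : ℕ, 2 * lam + n ≠ 0) (hc : ∀ n : ℕ, lam + 1 / 2 + n ≠ 0) :
    ∃ δ : ℝ, 0 < δ ∧
      SolvesHyp (lam + 1 / 2) (a * b) δ (ordinaryHypergeometric a b (lam + 1 / 2)) ∧
      ∀ q ∈ Metric.ball (0 : ℂ) δ, ∀ p ∈ Metric.ball (0 : ℂ) δ,
        HasSum (fun n => genCoeff lam a b n * gegSeq lam (p + q - 2 * p * q) ((q - p) ^ 2) n)
          (ordinaryHypergeometric a b (lam + 1 / 2) p *
            ordinaryHypergeometric a b (lam + 1 / 2) q) := by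
  obtain ⟨δ, hδ, h⟩ := exists_radius_genFun hab h2 hc
  have e : genFun lam a b 0 = ordinaryHypergeometric a b (lam + 1 / 2) :=
    funext fun p => genFun_zero_left a b h2 p
  -- The case q = 0 shows that F itself solves the equation.
  have hF := (h 0 (Metric.mem_ball_self hδ)).2
  rw [e] at hF
  refine ⟨δ, hδ, hF, fun q hq p hp => ?_⟩
  have := (h q hq).2.eq_of_eq_zero hδ hc
    (hF.const_mul (ordinaryHypergeometric a b (lam + 1 / 2) q))
    (by rw [genFun_zero_right a b h2, ordinaryHypergeometric_zero, mul_one]) p hp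
  rw [mul_comm (ordinaryHypergeometric a b (lam + 1 / 2) p), ← this]
  simpa only [eval_gegPoly] using (h q hq).1 p hp

/-! ### Gegenbauer polynomials from their generating function -/

theorem iteratedDeriv_id_mul {h : ℂ → ℂ} (n : ℕ) (hh : AnalyticAt ℂ h 0) :
    iteratedDeriv n (fun t => t * h t) 0 = n * iteratedDeriv (n - 1) h 0 := by
  induction n generalizing h with
  | zero => simp
  | succ n ih =>
    have e : deriv (fun t => t * h t) =ᶠ[𝓝 0] fun t => h t + t * deriv h t := by
      filter_upwards [hh.eventually_analyticAt] with z hz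
      rw [((hasDerivAt_id' z).fun_mul hz.differentiableAt.hasDerivAt).deriv, one_mul]
    have hc : ContDiffAt ℂ n h 0 := hh.contDiffAt
    have hc' : ContDiffAt ℂ n (fun t => t * deriv h t) 0 :=
      (analyticAt_id.mul hh.deriv).contDiffAt
    rw [iteratedDeriv_succ', e.iteratedDeriv_eq, iteratedDeriv_fun_add hc hc', ih hh.deriv,
      Nat.add_sub_cancel]
    rcases n with _ | n
    · simp
    · rw [Nat.add_sub_cancel, ← iteratedDeriv_succ']
      push_cast
      ring

theorem gegenbauerC_eq_gegSeq (lam x : ℂ) (n : ℕ) : gegenbauerC lam n x = gegSeq lam x 1 n := by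
  set f : ℂ → ℂ := fun t => (1 - 2 * x * t + t ^ 2) ^ (-lam) with hf
  have hQc : ContinuousAt (fun t : ℂ => 1 - 2 * x * t + t ^ 2) 0 := by fun_prop
  have hQ0 : (1 - 2 * x * 0 + 0 ^ 2 : ℂ) = 1 := by ring
  have hQs : ∀ᶠ t in 𝓝 (0 : ℂ), 1 - 2 * x * t + t ^ 2 ∈ Complex.slitPlane :=
    hQc.eventually_mem (Complex.isOpen_slitPlane.mem_nhds (by rw [hQ0]; simp))
  have hQd : ∀ t, HasDerivAt (fun t : ℂ => 1 - 2 * x * t + t ^ 2) (2 * t - 2 * x) t := by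
    intro t
    have := (((hasDerivAt_id' t).const_mul (2 * x)).const_sub 1).fun_add (hasDerivAt_pow 2 t)
    refine this.congr_deriv ?_
    push_cast
    ring
  have hfd : ∀ᶠ t in 𝓝 (0 : ℂ), HasDerivAt f
      (-lam * (1 - 2 * x * t + t ^ 2) ^ (-lam - 1) * (2 * t - 2 * x)) t :=
    hQs.mono fun t ht => (hQd t).cpow_const ht
  have hfa : AnalyticAt ℂ f 0 :=
    Complex.analyticAt_iff_eventually_differentiableAt.mpr (hfd.mono fun t h => h.differentiableAt)
  have hda := hfa.deriv
  -- The equation Q f' = lam (2x - 2t) f, solved for f' so that every other term is a multiple of t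
  -- f', t · t f', f or t f.
  have hode : deriv f =ᶠ[𝓝 0] fun t => 2 * x * (t * deriv f t) - t * (t * deriv f t) +
      (2 * lam * x * f t - 2 * lam * (t * f t)) := by
    filter_upwards [hfd, hQs] with t h1 h2
    have h3 : (1 - 2 * x * t + t ^ 2) ^ (-lam - 1) * (1 - 2 * x * t + t ^ 2) = f t := by
      rw [Complex.cpow_sub _ _ (Complex.slitPlane_ne_zero h2), Complex.cpow_one,
        div_mul_cancel₀ _ (Complex.slitPlane_ne_zero h2)]
    rw [h1.deriv, ← h3]
    ring
  have hD : ∀ n : ℕ, iteratedDeriv (n + 1) f 0 = 2 * x * (n * iteratedDeriv n f 0) -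
      n * ((n - 1 : ℕ) * iteratedDeriv (n - 1) f 0) +
      (2 * lam * x * iteratedDeriv n f 0 - 2 * lam * (n * iteratedDeriv (n - 1) f 0)) := by
    intro n
    have a1 : AnalyticAt ℂ (fun t => t * deriv f t) 0 := analyticAt_id.mul hda
    have a2 : AnalyticAt ℂ (fun t => t * (t * deriv f t)) 0 := analyticAt_id.mul a1
    have a3 : AnalyticAt ℂ (fun t => t * f t) 0 := analyticAt_id.mul hfa
    have b1 : AnalyticAt ℂ (fun t => 2 * x * (t * deriv f t)) 0 := analyticAt_const.mul a1
    have b3 : AnalyticAt ℂ (fun t => 2 * lam * x * f t) 0 := analyticAt_const.mul hfa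
    have b4 : AnalyticAt ℂ (fun t => 2 * lam * (t * f t)) 0 := analyticAt_const.mul a3
    have hs : ∀ k : ℕ, k * iteratedDeriv (k - 1) (deriv f) 0 = k * iteratedDeriv k f 0 := by
      intro k
      rcases k with _ | k
      · simp
      · rw [Nat.add_sub_cancel, ← iteratedDeriv_succ']
    rw [iteratedDeriv_succ', hode.iteratedDeriv_eq,
      iteratedDeriv_fun_add (b1.fun_sub a2).contDiffAt (b3.fun_sub b4).contDiffAt,
      iteratedDeriv_fun_sub b1.contDiffAt a2.contDiffAt,
      iteratedDeriv_fun_sub b3.contDiffAt b4.contDiffAt,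
      iteratedDeriv_const_mul_field, iteratedDeriv_const_mul_field, iteratedDeriv_const_mul_field,
      iteratedDeriv_id_mul n hda, iteratedDeriv_id_mul n a1, iteratedDeriv_id_mul n hfa,
      iteratedDeriv_id_mul (n - 1) hda, hs, hs]
  have hf0 : f 0 = 1 := by
    simp only [hf, hQ0, Complex.one_cpow]
  refine eq_gegSeq_of_rec lam x 1 (fun n => gegenbauerC lam n x) ?_ ?_ (fun n => ?_) n
  · simp only [gegenbauerC, iteratedDeriv_zero, Nat.factorial_zero, Nat.cast_one, div_one]
    exact hf0
  · have := hD 0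
    simp only [gegenbauerC, Nat.factorial_one, Nat.cast_one, div_one]
    simp only [zero_add, iteratedDeriv_zero, hf0] at this
    rw [this]
    simp
  · have := hD (n + 1)
    simp only [gegenbauerC]
    rw [Nat.add_sub_cancel] at this
    have h0 : (n.factorial : ℂ) ≠ 0 := by exact_mod_cast n.factorial_ne_zero
    have h1 : (n : ℂ) + 1 ≠ 0 := by exact_mod_cast n.succ_ne_zero
    have h2 : (n : ℂ) + 2 ≠ 0 := by exact_mod_cast (by omega : n + 2 ≠ 0)
    have e1 : ((n + 2).factorial : ℂ) = (n + 2) * ((n + 1) * n.factorial) := by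
      rw [Nat.factorial_succ, Nat.factorial_succ]; push_cast; ring
    have e2 : ((n + 1).factorial : ℂ) = (n + 1) * n.factorial := by
      rw [Nat.factorial_succ]; push_cast; ring
    rw [e1, e2, this]
    push_cast
    field_simp
    ring

/-! ### Quadratic transformation -/

/-- The equation is invariant under p ↦ 1 - p, so it descends to the square of z = 1 - 2p. With b =
1/2 the new parameters lam ∓ 1/4 again add up to 2 lam, so the transformed equation has the same
shape. -/
theorem solvesHyp_quadratic {lam : ℂ} {δ : ℝ} (hδ : 0 < δ) {Φ : ℂ → ℂ}
    (hΦ : SolvesHyp (lam + 1 / 2) ((lam - 1 / 4) * (lam + 1 / 4)) δ Φ) :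
    ∃ ε : ℝ, 0 < ε ∧ SolvesHyp (lam + 1 / 2) ((2 * lam - 1 / 2) * (1 / 2)) ε
      (fun p => (1 - 2 * p) ^ (-(2 * lam - 1 / 2)) * Φ (1 - 1 / (1 - 2 * p) ^ 2)) := by
  set b := 2 * lam - 1 / 2 with hb
  set z : ℂ → ℂ := fun p => 1 - 2 * p with hz
  set y : ℂ → ℂ := fun p => 1 - 1 / (1 - 2 * p) ^ 2 with hy
  have hzc : ContinuousAt z 0 := by fun_prop
  have hyc : ContinuousAt y 0 := by
    have : (1 - 2 * (0 : ℂ)) ^ 2 ≠ 0 := by norm_num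
    fun_prop (disch := assumption)
  have ev : ∀ᶠ p in 𝓝 (0 : ℂ), z p ∈ Complex.slitPlane ∧ y p ∈ Metric.ball (0 : ℂ) δ := by
    refine (hzc.eventually_mem (Complex.isOpen_slitPlane.mem_nhds ?_)).and
      (hyc.eventually_mem (Metric.isOpen_ball.mem_nhds ?_))
    · simp [hz]
    · simpa [hy] using hδ
  obtain ⟨ε, hε, hball⟩ := Metric.eventually_nhds_iff_ball.mp ev
  have hzd : ∀ p, HasDerivAt z (-2) p := fun p => by
    simpa using ((hasDerivAt_id' p).const_mul 2).const_sub 1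
  have hyd : ∀ p, z p ≠ 0 → HasDerivAt y (-4 / z p ^ 3) p := by
    intro p hp
    have := (((hzd p).fun_pow 2).inv (pow_ne_zero 2 hp)).const_sub 1
    have e : y = fun p => 1 - (z p ^ 2)⁻¹ := by funext p; simp only [hy, hz, one_div]
    rw [e]
    refine this.congr_deriv ?_
    push_cast
    field_simp
    ring
  have hE : ∀ p, z p ∈ Complex.slitPlane →
      HasDerivAt (fun p => z p ^ (-b)) (2 * b * z p ^ (-b) / z p) p := by
    intro p hp
    have := (hzd p).cpow_const (c := -b) hp
    convert this using 1
    rw [Complex.cpow_sub _ _ (Complex.slitPlane_ne_zero hp), Complex.cpow_one]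
    ring
  have hΦ0 : ∀ p, y p ∈ Metric.ball (0 : ℂ) δ → z p ≠ 0 →
      HasDerivAt (fun p => Φ (y p)) (deriv Φ (y p) * (-4 / z p ^ 3)) p := fun p hp hzp =>
    (hΦ.analyticOnNhd _ hp).differentiableAt.hasDerivAt.comp p (hyd p hzp)
  have hΦ1 : ∀ p, y p ∈ Metric.ball (0 : ℂ) δ → z p ≠ 0 →
      HasDerivAt (fun p => deriv Φ (y p)) (deriv (deriv Φ) (y p) * (-4 / z p ^ 3)) p :=
    fun p hp hzp =>
    (hΦ.analyticOnNhd _ hp).deriv.differentiableAt.hasDerivAt.comp p (hyd p hzp)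
  have d1 : ∀ p ∈ Metric.ball (0 : ℂ) ε, HasDerivAt (fun p => z p ^ (-b) * Φ (y p))
      (z p ^ (-b) * (2 * b * Φ (y p) / z p - 4 * deriv Φ (y p) / z p ^ 3)) p := by
    intro p hp
    obtain ⟨h1, h2⟩ := hball p hp
    have h0 := Complex.slitPlane_ne_zero h1
    refine ((hE p h1).fun_mul (hΦ0 p h2 h0)).congr_deriv ?_
    field_simp
    ring
  have d2 : ∀ p ∈ Metric.ball (0 : ℂ) ε, HasDerivAt
      (fun p => z p ^ (-b) * (2 * b * Φ (y p) / z p - 4 * deriv Φ (y p) / z p ^ 3))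
      (z p ^ (-b) * (4 * b * (b + 1) * Φ (y p) / z p ^ 2 -
        8 * (2 * b + 3) * deriv Φ (y p) / z p ^ 4 +
        16 * deriv (deriv Φ) (y p) / z p ^ 6)) p := by
    intro p hp
    obtain ⟨h1, h2⟩ := hball p hp
    have h0 := Complex.slitPlane_ne_zero h1
    have k1 := ((hΦ0 p h2 h0).const_mul (2 * b)).fun_div (hzd p) h0
    have k2 := ((hΦ1 p h2 h0).const_mul 4).fun_div ((hzd p).fun_pow 3) (pow_ne_zero 3 h0)
    refine ((hE p h1).fun_mul (k1.fun_sub k2)).congr_deriv ?_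
    push_cast
    field_simp
    ring
  refine ⟨ε, hε, fun p hp => (d1 p hp).differentiableAt.differentiableWithinAt, fun p hp => ?_⟩
  have e1 : deriv (fun p => z p ^ (-b) * Φ (y p)) =ᶠ[𝓝 p]
      fun p => z p ^ (-b) * (2 * b * Φ (y p) / z p - 4 * deriv Φ (y p) / z p ^ 3) :=
    Filter.eventually_of_mem (Metric.isOpen_ball.mem_nhds hp) fun p hp => (d1 p hp).deriv
  have hd1 := (d1 p hp).deriv
  have hd2 := e1.deriv_eq.trans (d2 p hp).deriv
  obtain ⟨h1, h2⟩ := hball p hp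
  have h0 : z p ≠ 0 := Complex.slitPlane_ne_zero h1
  have ode := hΦ.2 _ h2
  change p * (1 - p) * deriv (deriv (fun p => z p ^ (-b) * Φ (y p))) p +
    (lam + 1 / 2) * (1 - 2 * p) * deriv (fun p => z p ^ (-b) * Φ (y p)) p =
    b * (1 / 2) * (z p ^ (-b) * Φ (y p))
  rw [hd1, hd2]
  have hyz : y p = 1 - 1 / z p ^ 2 := rfl
  have hpz : p = (1 - z p) / 2 := by simp only [hz]; ring
  generalize z p ^ (-b) = E
  generalize deriv (deriv Φ) (y p) = F2 at *
  generalize deriv Φ (y p) = F1 at *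
  generalize Φ (y p) = F0 at *
  rw [hyz] at ode
  generalize z p = Z at *
  rw [hpz, hb]
  -- The equation for Φ at y = 1 - 1/Z², multiplied by Z⁴.
  have ode' : (Z ^ 2 - 1) * F2 + (lam + 1 / 2) * (2 - Z ^ 2) * Z ^ 2 * F1 -
      (lam - 1 / 4) * (lam + 1 / 4) * Z ^ 4 * F0 = 0 := by
    field_simp at ode
    linear_combination ode / 32
  field_simp
  linear_combination -64 * E * ode'

theorem ordinaryHypergeometric_quadratic {lam : ℂ} (h2 : ∀ n : ℕ, 2 * lam + n ≠ 0)
    (hc : ∀ n : ℕ, lam + 1 / 2 + n ≠ 0) :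
    ∀ᶠ z in 𝓝 (1 : ℂ),
      ordinaryHypergeometric (2 * lam - 1 / 2) (1 / 2) (lam + 1 / 2) ((1 - z) / 2) =
        z ^ (-(2 * lam - 1 / 2)) *
          ordinaryHypergeometric (lam - 1 / 4) (lam + 1 / 4) (lam + 1 / 2) (1 - 1 / z ^ 2) := by
  obtain ⟨δ₁, hδ₁, hF, -⟩ := exists_radius_hypergeometric
    (by ring : (2 * lam - 1 / 2) + 1 / 2 = 2 * lam) h2 hc
  obtain ⟨δ₂, hδ₂, hΦ, -⟩ := exists_radius_hypergeometric
    (by ring : (lam - 1 / 4) + (lam + 1 / 4) = 2 * lam) h2 hc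
  obtain ⟨ε, hε, hW⟩ := solvesHyp_quadratic hδ₂ hΦ
  have hm : 0 < min δ₁ ε := lt_min hδ₁ hε
  have key := (hF.mono (min_le_left δ₁ ε)).eq_of_eq_zero hm hc (hW.mono (min_le_right δ₁ ε))
    (by simp)
  have ht : ContinuousAt (fun z : ℂ => (1 - z) / 2) 1 := by fun_prop
  have hev : ∀ᶠ z in 𝓝 (1 : ℂ), (1 - z) / 2 ∈ Metric.ball (0 : ℂ) (min δ₁ ε) :=
    ht.eventually_mem (Metric.isOpen_ball.mem_nhds (by simpa using hm))
  filter_upwards [hev] with z hz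
  rw [key _ hz, show 1 - 2 * ((1 - z) / 2) = z by ring]

/-! ### Legendre and Ferrers functions near z = 1 -/

/-- Both branches of the definition have this germ at 0, so the existence of the continuation plays
no role. -/
theorem gaussF_eventuallyEq {a b c : ℂ} :
    gaussF a b c =ᶠ[𝓝 0] ordinaryHypergeometric a b c := by
  unfold gaussF
  split_ifs with h
  · exact h.choose_spec.2
  · exact Filter.EventuallyEq.rfl

theorem cpow_mul_cpow_neg {w : ℂ} (s : ℂ) (hw : w ≠ 0) : w ^ s * w ^ (-s) = 1 := by
  rw [← Complex.cpow_add _ _ hw, add_neg_cancel, Complex.cpow_zero]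

theorem sqSubOnePow_mul_legendreP (ν μ : ℂ) {z : ℂ} (hz : z ∈ legendreDomain) (hz' : z ≠ -1) :
    sqSubOnePow z (μ / 2) * legendreP ν μ z = 2 ^ μ / Complex.Gamma (1 - μ) *
      gaussF (-ν - μ) (1 + ν - μ) (1 - μ) ((1 - z) / 2) := by
  have h1 : z - 1 ≠ 0 := by
    intro h
    rw [sub_eq_zero] at h
    subst h
    exact hz (by simp)
  have h2 : z + 1 ≠ 0 := fun h => hz' (eq_neg_of_add_eq_zero_left h)
  have e1 := cpow_mul_cpow_neg (μ / 2) h1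
  have e2 := cpow_mul_cpow_neg (μ / 2) h2
  simp only [sqSubOnePow, legendreP, neg_div]
  linear_combination (2 ^ μ / Complex.Gamma (1 - μ) *
    gaussF (-ν - μ) (1 + ν - μ) (1 - μ) ((1 - z) / 2)) *
      ((z + 1) ^ (μ / 2) * (z + 1) ^ (-(μ / 2)) * e1 + e2)

theorem ne_neg_one_of_mem_legendreDomain {z : ℂ} (hz : z ∈ legendreDomain) : z ≠ -1 := by
  rintro rfl
  exact hz (by simp)

theorem ferrersP_mul (ν μ : ℂ) {z : ℂ} (hz : z ∈ ferrersDomain) :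
    (1 - z ^ 2) ^ (μ / 2) * ferrersP ν μ z = 2 ^ μ / Complex.Gamma (1 - μ) *
      gaussF (-ν - μ) (1 + ν - μ) (1 - μ) ((1 - z) / 2) := by
  have h : 1 - z ^ 2 ≠ 0 := by
    intro h
    have : (1 - z) * (1 + z) = 0 := by linear_combination h
    rcases mul_eq_zero.mp this with h | h
    · rw [sub_eq_zero] at h
      subst h
      exact hz (by simp)
    · have : z = -1 := by linear_combination h
      subst this
      exact hz (by simp)
  have e := cpow_mul_cpow_neg (μ / 2) h
  simp only [ferrersP, neg_div]
  linear_combination (2 ^ μ / Complex.Gamma (1 - μ) *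
    gaussF (-ν - μ) (1 + ν - μ) (1 - μ) ((1 - z) / 2)) * e

theorem scriptF_of_mem_legendreDomain (ν μ : ℂ) {z : ℂ} (hz : z ∈ legendreDomain) :
    scriptF ν μ z = sqSubOnePow z (μ / 2) * legendreP ν μ z := if_pos hz

theorem scriptF_of_mem_ferrersDomain (ν μ : ℂ) {z : ℂ} (hz : z ∈ ferrersDomain) :
    scriptF ν μ z = (1 - z ^ 2) ^ (μ / 2) * ferrersP ν μ z := by
  by_cases h : z ∈ legendreDomain
  · rw [scriptF_of_mem_legendreDomain ν μ h,
      sqSubOnePow_mul_legendreP ν μ h (ne_neg_one_of_mem_legendreDomain h), ferrersP_mul ν μ hz]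
  · rw [scriptF, if_neg h, if_pos hz]

theorem scriptF_eventuallyEq (ν μ : ℂ) :
    scriptF ν μ =ᶠ[𝓝 1] fun z => 2 ^ μ / Complex.Gamma (1 - μ) *
      ordinaryHypergeometric (-ν - μ) (1 + ν - μ) (1 - μ) ((1 - z) / 2) := by
  have ht : Filter.Tendsto (fun z : ℂ => (1 - z) / 2) (𝓝 1) (𝓝 0) := by
    have : ContinuousAt (fun z : ℂ => (1 - z) / 2) 1 := by fun_prop
    simpa [ContinuousAt] using this
  have hre : ∀ᶠ z : ℂ in 𝓝 1, -1 < z.re :=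
    Complex.continuous_re.continuousAt.eventually_const_lt (by simp)
  filter_upwards [ht.eventually gaussF_eventuallyEq, hre] with z h1 h2
  rw [← h1]
  by_cases hl : z ∈ legendreDomain
  · rw [scriptF_of_mem_legendreDomain ν μ hl,
      sqSubOnePow_mul_legendreP ν μ hl (ne_neg_one_of_mem_legendreDomain hl)]
  · by_cases hf : z ∈ ferrersDomain
    · rw [scriptF_of_mem_ferrersDomain ν μ hf, ferrersP_mul ν μ hf]
    · have hz : z = 1 := by
        simp only [legendreDomain, ferrersDomain, Set.mem_ofPred_eq, not_not] at hl hf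
        apply Complex.ext
        · rcases hf.2 with h | h
          · linarith
          · exact le_antisymm hl.2 h
        · exact hl.1
      subst hz
      rw [h1, scriptF, if_neg hl, if_neg hf, if_pos rfl]
      simp

/-! ### Return to the variables x and t -/

theorem genR_sq (x t : ℂ) : genR x t ^ 2 = 1 - 2 * x * t + t ^ 2 := by
  rw [genR, one_div]
  exact Complex.cpow_ofNat_inv_pow _ 2

theorem tendsto_genR (x : ℂ) : Filter.Tendsto (genR x) (𝓝 0) (𝓝 1) := by
  have h : ContinuousAt (genR x) 0 := by
    unfold genR
    exact ContinuousAt.cpow (by fun_prop) continuousAt_const (by simp)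
  simpa [ContinuousAt, genR] using h

theorem hasSum_gegenbauerC {lam a b : ℂ} (hab : a + b = 2 * lam)
    (h2 : ∀ n : ℕ, 2 * lam + n ≠ 0) (hc : ∀ n : ℕ, lam + 1 / 2 + n ≠ 0) (x : ℂ) :
    ∀ᶠ t in 𝓝 (0 : ℂ),
      HasSum (fun n => genCoeff lam a b n * gegenbauerC lam n x * t ^ n)
        (ordinaryHypergeometric a b (lam + 1 / 2) ((1 - (genR x t + t)) / 2) *
          ordinaryHypergeometric a b (lam + 1 / 2) ((1 - (genR x t - t)) / 2)) := by
  obtain ⟨δ, hδ, -, h⟩ := exists_radius_hypergeometric hab h2 hc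
  have hR := tendsto_genR x
  have hp : Filter.Tendsto (fun t => (1 - (genR x t + t)) / 2) (𝓝 0) (𝓝 0) := by
    simpa using ((hR.add Filter.tendsto_id).const_sub 1).div_const 2
  have hq : Filter.Tendsto (fun t => (1 - (genR x t - t)) / 2) (𝓝 0) (𝓝 0) := by
    simpa using ((hR.sub Filter.tendsto_id).const_sub 1).div_const 2
  have hb := Metric.ball_mem_nhds (0 : ℂ) hδ
  filter_upwards [hp.eventually_mem hb, hq.eventually_mem hb] with t h1 h2
  convert h _ h2 _ h1 using 2 with n
  have e1 : (1 - (genR x t + t)) / 2 + (1 - (genR x t - t)) / 2 -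
      2 * ((1 - (genR x t + t)) / 2) * ((1 - (genR x t - t)) / 2) = x * t := by
    linear_combination (-1 / 2) * genR_sq x t
  have e2 : ((1 - (genR x t - t)) / 2 - (1 - (genR x t + t)) / 2) ^ 2 = 1 * t ^ 2 := by ring
  rw [e1, e2, gegSeq_mul_sq, gegenbauerC_eq_gegSeq, mul_assoc]

/-- Both arguments lie in (-π/2, π/2), so their sum stays within the principal range. -/
theorem mul_cpow_of_re_pos {u v : ℂ} (hu : 0 < u.re) (hv : 0 < v.re) (s : ℂ) :
    (u * v) ^ s = u ^ s * v ^ s := by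
  have h1 := abs_lt.mp (Complex.abs_arg_lt_pi_div_two_iff.mpr (Or.inl hu))
  have h2 := abs_lt.mp (Complex.abs_arg_lt_pi_div_two_iff.mpr (Or.inl hv))
  have hu0 : u ≠ 0 := fun h => by simp [h] at hu
  have hv0 : v ≠ 0 := fun h => by simp [h] at hv
  rw [Complex.cpow_def_of_ne_zero hu0, Complex.cpow_def_of_ne_zero hv0,
    Complex.cpow_def_of_ne_zero (mul_ne_zero hu0 hv0), ← Complex.exp_add,
    Complex.log_mul hu0 hv0 ⟨by linarith, by linarith⟩, add_mul]

end

/-! ### The two identities and the analyticity at 1 -/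

theorem mainTheorem10 (μ : ℂ) (hμ : ∀ k : ℕ, μ ≠ ((k : ℂ) + 1) / 2) :
    -- the first identity
    (∀ ν x : ℂ, ∀ᶠ t in 𝓝 (0 : ℂ),
      HasSum
        (fun n : ℕ =>
          poch (-ν - μ) n * poch (1 + ν - μ) n / (poch (1 - 2 * μ) n * poch (1 - μ) n) *
            gegenbauerC (1 / 2 - μ) n x * t ^ n)
        (2 ^ (-2 * μ) * Complex.Gamma (1 - μ) ^ 2 *
          scriptF ν μ (genR x t + t) * scriptF ν μ (genR x t - t))) ∧
    -- the companion identity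
    (∀ x : ℂ, ∀ᶠ t in 𝓝 (0 : ℂ),
      HasSum
        (fun n : ℕ =>
          poch (1 / 2 - 2 * μ) n * poch (1 / 2) n / (poch (1 - 2 * μ) n * poch (1 - μ) n) *
            gegenbauerC (1 / 2 - μ) n x * t ^ n)
        (2 ^ (-2 * μ) * Complex.Gamma (1 - μ) ^ 2 * (1 - 2 * x * t) ^ (2 * μ - 1 / 2) *
          scriptF (-1 / 4) μ (2 / (genR x t - t) ^ 2 - 1) *
          scriptF (-1 / 4) μ (2 / (genR x t + t) ^ 2 - 1))) ∧
    -- the two definitions of `𝓕_ν^μ` are equivalent, and it is analytic at `z = 1`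
    (∀ ν : ℂ,
      (∀ z ∈ legendreDomain, scriptF ν μ z = sqSubOnePow z (μ / 2) * legendreP ν μ z) ∧
      (∀ z ∈ ferrersDomain, scriptF ν μ z = (1 - z ^ 2) ^ (μ / 2) * ferrersP ν μ z) ∧
      AnalyticAt ℂ (scriptF ν μ) 1) := by
  have h2 : ∀ n : ℕ, 2 * (1 / 2 - μ) + n ≠ 0 := fun n h =>
    hμ n (by linear_combination (-1 / 2) * h)
  -- A zero of (1 - μ)_n is an integer μ = n + 1, the half-integer ((2n + 1) + 1)/2.
  have hc : ∀ n : ℕ, (1 / 2 - μ) + 1 / 2 + n ≠ 0 := fun n h =>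
    hμ (2 * n + 1) (by push_cast; linear_combination -h)
  have e1 : (1 / 2 - μ) + 1 / 2 = 1 - μ := by ring
  have e2 : 2 * (1 / 2 - μ) = 1 - 2 * μ := by ring
  have hΓ : Complex.Gamma (1 - μ) ≠ 0 := Complex.Gamma_ne_zero fun n h =>
    hc n (by linear_combination h)
  have hpow : (2 : ℂ) ^ (-2 * μ) * (2 ^ μ) ^ 2 = 1 := by
    rw [← Complex.cpow_nat_mul, ← Complex.cpow_add _ _ two_ne_zero]
    simp
  have hconst : (2 : ℂ) ^ (-2 * μ) * Complex.Gamma (1 - μ) ^ 2 *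
      (2 ^ μ / Complex.Gamma (1 - μ)) ^ 2 = 1 := by
    rw [div_pow, mul_assoc, mul_div_cancel₀ _ (pow_ne_zero 2 hΓ), hpow]
  have hcoeff : ∀ a b : ℂ, ∀ n : ℕ, genCoeff (1 / 2 - μ) a b n =
      poch a n * poch b n / (poch (1 - 2 * μ) n * poch (1 - μ) n) := fun a b n => by
    rw [genCoeff, e1, e2]
  refine ⟨fun ν x => ?_, fun x => ?_, fun ν => ⟨fun z hz => scriptF_of_mem_legendreDomain ν μ hz,
    fun z hz => scriptF_of_mem_ferrersDomain ν μ hz, ?_⟩⟩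
  · have hR := tendsto_genR x
    have hp : Filter.Tendsto (fun t => genR x t + t) (𝓝 0) (𝓝 1) := by
      simpa using hR.add Filter.tendsto_id
    have hq : Filter.Tendsto (fun t => genR x t - t) (𝓝 0) (𝓝 1) := by
      simpa using hR.sub Filter.tendsto_id
    filter_upwards [hasSum_gegenbauerC
      (by ring : (-ν - μ) + (1 + ν - μ) = 2 * (1 / 2 - μ)) h2 hc x,
      hp.eventually (scriptF_eventuallyEq ν μ), hq.eventually (scriptF_eventuallyEq ν μ)]
      with t ht h3 h4
    simp only [hcoeff, e1] at ht
    rw [h3, h4]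
    convert ht using 1
    linear_combination
      (ordinaryHypergeometric (-ν - μ) (1 + ν - μ) (1 - μ) ((1 - (genR x t + t)) / 2) *
        ordinaryHypergeometric (-ν - μ) (1 + ν - μ) (1 - μ) ((1 - (genR x t - t)) / 2)) * hconst
  · have hR := tendsto_genR x
    have hp : Filter.Tendsto (fun t => genR x t + t) (𝓝 0) (𝓝 1) := by
      simpa using hR.add Filter.tendsto_id
    have hq : Filter.Tendsto (fun t => genR x t - t) (𝓝 0) (𝓝 1) := by
      simpa using hR.sub Filter.tendsto_id
    have hre : ∀ᶠ z : ℂ in 𝓝 1, 0 < z.re :=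
      Complex.continuous_re.continuousAt.eventually_const_lt (by simp)
    have hinv : Filter.Tendsto (fun z : ℂ => 2 / z ^ 2 - 1) (𝓝 1) (𝓝 1) := by
      have : ContinuousAt (fun z : ℂ => 2 / z ^ 2 - 1) 1 := by
        have : (1 : ℂ) ^ 2 ≠ 0 := by norm_num
        fun_prop (disch := assumption)
      have h1 : (2 / (1 : ℂ) ^ 2 - 1) = 1 := by norm_num
      rwa [ContinuousAt, h1] at this
    have hS := hinv.eventually (scriptF_eventuallyEq (-1 / 4) μ)
    have hquad := ordinaryHypergeometric_quadratic h2 hc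
    filter_upwards [hasSum_gegenbauerC
      (by ring : (1 / 2 - 2 * μ) + 1 / 2 = 2 * (1 / 2 - μ)) h2 hc x,
      hp.eventually hS, hq.eventually hS, hp.eventually hquad, hq.eventually hquad,
      hp.eventually hre, hq.eventually hre] with t ht s1 s2 q1 q2 r1 r2
    simp only [hcoeff, e1] at ht
    have f1 : 2 * (1 / 2 - μ) - 1 / 2 = 1 / 2 - 2 * μ := by ring
    have f2 : (1 / 2 - μ) - 1 / 4 = -(-1 / 4) - μ := by ring
    have f3 : (1 / 2 - μ) + 1 / 4 = 1 + -1 / 4 - μ := by ring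
    have f4 : -(1 / 2 - 2 * μ) = 2 * μ - 1 / 2 := by ring
    rw [f1, f2, f3, f4, e1] at q1 q2
    have g : ∀ z : ℂ, (1 - (2 / z ^ 2 - 1)) / 2 = 1 - 1 / z ^ 2 := fun z => by ring
    -- R ± t are near 1 and have positive real part, so the power of 1 - 2xt splits into the two
    -- prefactors of the quadratic transformation.
    have hprod : 1 - 2 * x * t = (genR x t + t) * (genR x t - t) := by
      linear_combination -genR_sq x t
    rw [q1, q2] at ht
    rw [s1, s2, g, g, hprod, mul_cpow_of_re_pos r1 r2]
    convert ht using 1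
    linear_combination ((genR x t + t) ^ (2 * μ - 1 / 2) * (genR x t - t) ^ (2 * μ - 1 / 2) *
      ordinaryHypergeometric (-(-1 / 4) - μ) (1 + -1 / 4 - μ) (1 - μ)
        (1 - 1 / (genR x t + t) ^ 2) *
      ordinaryHypergeometric (-(-1 / 4) - μ) (1 + -1 / 4 - μ) (1 - μ)
        (1 - 1 / (genR x t - t) ^ 2)) * hconst
  · obtain ⟨δ, hδ, hF, -⟩ := exists_radius_hypergeometric
      (by ring : (-ν - μ) + (1 + ν - μ) = 2 * (1 / 2 - μ)) h2 hc
    rw [e1] at hF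
    refine AnalyticAt.congr (analyticAt_const.mul ?_) (scriptF_eventuallyEq ν μ).symm
    have h0 : (1 - (1 : ℂ)) / 2 = 0 := by norm_num
    have ha := hF.analyticOnNhd 0 (Metric.mem_ball_self hδ)
    rw [← h0] at ha
    exact ha.comp (f := fun z : ℂ => (1 - z) / 2)
      ((analyticAt_const.sub analyticAt_id).div_const)
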